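/- Let $R$ be a finite commutative chain ring (that is, the ideals of $R$ form a chain) with maximal ideal $\langle\gamma\rangle$, where $\gamma$ has nilpotency index $2$ (so $\gamma\neq 0=\gamma^2$). Let $p$ be a prime and $R/\langle\gamma\rangle$ have $p^m$ elements, let $\zeta\in R$ have multiplicative order $p^m-1$, and let $\mathcal T=\{0,1,\zeta,\dots,\zeta^{p^m-2}\}$ be the Teichmüller set. Let $n,s\ge 1$ be integers with $\gcd(n,p)=1$ and let $\alpha\in\mathcal T\setminus\{0\}$. Write $\mathcal P_d(\mathcal T)$ for the set of polynomials in $R[x]$ with all coefficients in $\mathcal T$ that are zero or of degree less than $d$. Then there exist $\alpha_0\in\mathcal T$ with $\alpha_0^{p^s}=\alpha$, monic pairwise coprime polynomials $f_1,\dots,f_r\in R[x]$ that are irreducible modulo $\gamma$, and polynomials $g_1,\dots,g_r\in R[x]$, such that $$x^n-\alpha_0=\prod_{j=1}^r f_j(x),\qquad x^{np^s}-\alpha=\prod_{j=1}^r\big(f_j(x)^{p^s}+\gamma g_j(x)\big).$$ For every such choice put $K_j=R[x]/\langle f_j(x)^{p^s}+\gamma g_j(x)\rangle$ and $d_j=\deg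 f_j$. For each $j$, every ideal of $K_j$ is of exactly one of the following four types, and the listed ideals are pairwise distinct (that is, the parameters shown are determined by the ideal, where $t$ is disregarded if $G=0$). - Type I: $\{0\}$ and $K_j$. - Type II: $\langle\gamma f_j^\tau\rangle$ with $0\le\tau<p^s$. - Type III (principal): $\langle f_j^\omega+\gamma f_j^tG\rangle$ with $0<\omega<p^s$, where either $G=0$, or $0\le t<\kappa$ and $G$ is a unit of $K_j$ of the form $\sum_{i=0}^{\kappa-t-1}a_i(x)f_j(x)^i$ with all $a_i\in\mathcal P_{d_j}(\mathcal T)$. Here $\kappa$ is the smallest integer with $0\le\kappa\le\omega$ and $\gamma f_j^\kappa\in\langle f_j^\omega+\gamma f_j^tG\rangle$. - Type IV (non-principal): $\langle f_j^\omega+\gamma f_j^tG,\ \gamma f_j^\mu\rangle$ with $0\le\mu<\kappa\le\omega<p^s$, where either $G=0$, or $0\le t<\mu$ and $G$ is a unit of $K_j$ of the form $\sum_{i=0}^{\mu-t-1}a_i(x)f_j(x)^i$ with all $a_i\in\mathcal P_{d_j}(\mathcal T)$. Here $\kappa$ is the smallest non-negative integer with $\gamma f_j^\kappa\in\langle f_j^\omega+\gamma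 f_j^tG\rangle$. No ideal of Type IV is principal. Moreover, call an $R$-submodule $\mathcal C$ of $R^{np^s}$ an $\alpha$-constacyclic code of length $np^s$ over $R$ if $(c_0,\dots,c_{np^s-1})\in\mathcal C$ implies $(\alpha c_{np^s-1},c_0,\dots,c_{np^s-2})\in\mathcal C$. Then sending a family $(I_1,\dots,I_r)$ of listed ideals $I_j\subseteq K_j$ to $$\Big\{c\in R^{np^s}:\ \textstyle\sum_i c_ix^i \bmod \big(f_j(x)^{p^s}+\gamma g_j(x)\big)\in I_j\ \text{ for all } j\Big\}$$ is a bijection onto the set of $\alpha$-constacyclic codes of length $np^s$ over $R$. -/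

import Mathlib

open Polynomial

namespace ChainCode

/-- A commutative ring is a chain ring if its ideals form a chain under inclusion. -/
def IsChainRing (R : Type*) [CommRing R] : Prop :=
  ∀ I J : Ideal R, I ≤ J ∨ J ≤ I

/-- The set `{0, 1, ζ, …, ζ ^ (q - 2)}`. It is the Teichmüller set when `q` is the number of
elements of the residue field and `ζ` has multiplicative order `q - 1`. -/
def teichmullerSet {R : Type*} [CommRing R] (ζ : R) (q : ℕ) : Set R :=
  {a | a = 0 ∨ ∃ i < q - 1, a = ζ ^ i}

/-- The polynomials over `R` of degree less than `d` (including `0`) all of whose coefficients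
lie in `S`. -/
def polysLT {R : Type*} [CommRing R] (S : Set R) (d : ℕ) : Set R[X] :=
  {a | a.degree < d ∧ ∀ i, a.coeff i ∈ S}

/-- `f` is basic irreducible: its reduction modulo `γ` is irreducible. -/
def IsBasicIrreducible {R : Type*} [CommRing R] (γ : R) (f : R[X]) : Prop :=
  Irreducible (f.map (Ideal.Quotient.mk (Ideal.span {γ})))

/-- The factorizations that define the local components: `α₀` is the Teichmüller element with
`α₀ ^ (p ^ s) = α`, `X ^ n - α₀` is the product of the monic basic irreducible pairwise coprime
`f j`, and `X ^ (n * p ^ s) - α` is the product of the `f j ^ (p ^ s) + γ * g j`. -/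
structure IsFactorization {R : Type*} [CommRing R] (γ : R) (T : Set R) (α : R) (n p s : ℕ)
    (α₀ : R) {r : ℕ} (f g : Fin r → R[X]) : Prop where
  root_mem : α₀ ∈ T
  root_pow : α₀ ^ p ^ s = α
  monic : ∀ j, (f j).Monic
  basicIrreducible : ∀ j, IsBasicIrreducible γ (f j)
  coprime : Pairwise fun i j => IsCoprime (f i) (f j)
  prod_eq : ∏ j, f j = X ^ n - C α₀
  prod_lift_eq : ∏ j, (f j ^ p ^ s + C γ * g j) = X ^ (n * p ^ s) - C α

/-- The ring `R[X] ⧸ ⟨f ^ N + γ g⟩`. -/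
abbrev LocalComponent {R : Type*} [CommRing R] (γ : R) (N : ℕ) (f g : R[X]) : Type _ :=
  R[X] ⧸ Ideal.span {f ^ N + C γ * g}

/-- The residue class in `R[X] ⧸ ⟨f ^ N + γ g⟩` of a polynomial. -/
noncomputable abbrev cls {R : Type*} [CommRing R] (γ : R) (N : ℕ) (f g : R[X]) :
    R[X] →+* LocalComponent γ N f g :=
  Ideal.Quotient.mk (Ideal.span {f ^ N + C γ * g})

/-- The entries of the list of ideals of a ring `K`, with their parameters. -/
inductive Entry (K : Type*) where
  /-- Type I: the zero ideal. -/
  | zero : Entry K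
  /-- Type I: the whole ring. -/
  | whole : Entry K
  /-- Type II: `⟨γ f ^ τ⟩`. -/
  | typeII (τ : ℕ) : Entry K
  /-- Type III: `⟨f ^ ω + γ f ^ t G⟩`. -/
  | typeIII (ω t : ℕ) (G : K) : Entry K
  /-- Type IV: `⟨f ^ ω + γ f ^ t G, γ f ^ μ⟩`. -/
  | typeIV (ω μ t : ℕ) (G : K) : Entry K

section

variable {R : Type*} [CommRing R] (γ : R) (N : ℕ) (f g : R[X])

/-- The element `f ^ ω + γ f ^ t G`. -/
noncomputable def gen (ω t : ℕ) (G : LocalComponent γ N f g) : LocalComponent γ N f g :=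
  cls γ N f g f ^ ω + cls γ N f g (C γ) * cls γ N f g f ^ t * G

/-- The ideal that an entry of the list stands for. -/
noncomputable def Entry.toIdeal : Entry (LocalComponent γ N f g) → Ideal (LocalComponent γ N f g)
  | .zero => ⊥
  | .whole => ⊤
  | .typeII τ => Ideal.span {cls γ N f g (C γ) * cls γ N f g f ^ τ}
  | .typeIII ω t G => Ideal.span {gen γ N f g ω t G}
  | .typeIV ω μ t G =>
      Ideal.span {gen γ N f g ω t G, cls γ N f g (C γ) * cls γ N f g f ^ μ}

/-- The exponents `k` with `γ f ^ k ∈ ⟨f ^ ω + γ f ^ t G⟩`; the least one is `κ`. -/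
def torsionExponents (ω t : ℕ) (G : LocalComponent γ N f g) : Set ℕ :=
  {k | cls γ N f g (C γ) * cls γ N f g f ^ k ∈ Ideal.span {gen γ N f g ω t G}}

/-- The condition on `t` and `G`, with bound `b`: either `G = 0`, or `0 ≤ t < b` and `G` is a unit
of the form `∑ i < b - t, a i * f ^ i` with `a i` of degree `< deg f` and coefficients in `T`.
For `G = 0` the exponent `t` has no meaning; it is set to `0` so that each ideal
appears once. -/
def IsTail (T : Set R) (b t : ℕ) (G : LocalComponent γ N f g) : Prop :=
  (G = 0 ∧ t = 0) ∨
  (t < b ∧ IsUnit G ∧ ∃ a : ℕ → R[X], (∀ i, a i ∈ polysLT T f.natDegree) ∧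
    G = ∑ i ∈ Finset.range (b - t), cls γ N f g (a i) * cls γ N f g f ^ i)

/-- The constraints that the list puts on the parameters of an entry. -/
def Entry.IsListed (T : Set R) : Entry (LocalComponent γ N f g) → Prop
  | .zero => True
  | .whole => True
  | .typeII τ => τ < N
  | .typeIII ω t G => 0 < ω ∧ ω < N ∧
      ∃ κ, IsLeast {k | k ≤ ω ∧ k ∈ torsionExponents γ N f g ω t G} κ ∧
        IsTail γ N f g T κ t G
  | .typeIV ω μ t G => ω < N ∧
      ∃ κ, IsLeast (torsionExponents γ N f g ω t G) κ ∧ μ < κ ∧ κ ≤ ω ∧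
        IsTail γ N f g T μ t G

end

/-- The constacyclic shift `(c₀, …, c_{N-1}) ↦ (a c_{N-1}, c₀, …, c_{N-2})`. -/
def constaShift {R : Type*} [CommRing R] {N : ℕ} (a : R) (c : Fin N → R) : Fin N → R :=
  fun i => if i.val = 0 then a * c ⟨N - 1, by have := i.isLt; omega⟩
    else c ⟨i.val - 1, by have := i.isLt; omega⟩

/-- An `a`-constacyclic code of length `N` over `R`. -/
def IsConstacyclic {R : Type*} [CommRing R] {N : ℕ} (a : R) (D : Submodule R (Fin N → R)) : Prop :=
  ∀ c ∈ D, constaShift a c ∈ D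

/-- The polynomial `c₀ + c₁ X + ⋯ + c_{N-1} X ^ (N-1)` of a word. -/
noncomputable def wordPoly {R : Type*} [CommRing R] {N : ℕ} (c : Fin N → R) : R[X] :=
  ∑ i, C (c i) * X ^ (i : ℕ)

/-- The code `⊕ⱼ Iⱼ` of length `L` given by ideals `Iⱼ` of the rings `R[X] ⧸ ⟨f j ^ N + γ g j⟩`
through the Chinese remainder decomposition: the words whose polynomial has its `j`-th residue
class in `Iⱼ`, for all `j`. -/
noncomputable def directSumCode {R : Type*} [CommRing R] (γ : R) (N L : ℕ) {r : ℕ}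
    (f g : Fin r → R[X]) (I : ∀ j, Ideal (LocalComponent γ N (f j) (g j))) :
    Submodule R (Fin L → R) where
  carrier := {c | ∀ j, cls γ N (f j) (g j) (wordPoly c) ∈ I j}
  add_mem' := by
    intro a b ha hb j
    have h : wordPoly (a + b) = wordPoly a + wordPoly b := by
      simp [wordPoly, add_mul, Finset.sum_add_distrib]
    rw [h, map_add]
    exact (I j).add_mem (ha j) (hb j)
  zero_mem' := by
    intro j
    have h : wordPoly (0 : Fin L → R) = 0 := by simp [wordPoly]
    rw [h, map_zero]
    exact (I j).zero_mem
  smul_mem' := by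
    intro x a ha j
    have h : wordPoly (x • a) = C x * wordPoly a := by
      simp [wordPoly, Finset.mul_sum, mul_assoc]
    rw [h, map_mul]
    exact (I j).mul_mem_left _ (ha j)

end ChainCode

/-! ### Ideals of a local ring with residual uniformizer `φ` and square-zero `c`. -/

namespace ChainCode

/-! Let `K = R[X] ⧸ ⟨f ^ N + γ g⟩`, with `c`, `φ` the classes of `γ`, `f`, and let `F` be the
residue field. Then `K ⧸ cK = F[X] ⧸ ⟨f ^ N⟩` is a chain ring with uniformizer `φ`, and the
annihilator of `c` is `cK`. Hence every element is a unit times a power of `φ` modulo `c`, and `c x`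
depends only on `x` modulo `c`.

An ideal `I` therefore has two invariants: `ω`, the exponent of its image modulo `c`, and `μ`, the
exponent of its torsion `{x | c x ∈ I}`. It is generated by `c φ ^ μ` and any lift `φ ^ ω + c y` of
`φ ^ ω` (`eq_span_pair`). The lift matters only through `y` modulo `φ ^ μ` and `c`. Expanding `y` in
powers of `φ` with Teichmüller digits and removing the leading zeros gives a unique `φ ^ t * G`
(`exists_normalTail`, `normalTail_unique`). The values `ω = 0` and `ω = N` give the whole ring, the
zero ideal and Type II. For `0 < ω < N`, let `κ` be the torsion exponent of the ideal generated by
the lift alone: `μ = κ` is Type III and `μ < κ` is Type IV.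

Constacyclic codes are the ideals of `R[X] ⧸ ⟨X ^ L - α⟩`, which split by the Chinese remainder
theorem. The factorizations exist because `X ^ n - α₀` is separable modulo `γ` and, as `γ ^ 2 = 0`,
one correction lifts a coprime factorization (`exists_prod_eq`). -/

/-- The features of the ring `K = R[X] ⧸ ⟨f ^ N + γ g⟩` on which the classification of its ideals
rests, with `c` the class of `γ`, `φ` the class of `f`, and `S` a set of representatives
of the residue field of `K`. -/
structure IsLocalData {K : Type*} [CommRing K] (c φ : K) (N : ℕ) (S : Set K) : Prop where
  mul_eq_zero_iff : ∀ x, c * x = 0 ↔ c ∣ x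
  isUnit_or : ∀ x, IsUnit x ∨ ∃ y z, x = φ * y + c * z
  dvd_pow : c ∣ φ ^ N
  not_dvd_pow : ∀ k < N, ¬ c ∣ φ ^ k
  zero_mem : (0 : K) ∈ S
  exists_rep : ∀ x, ∃ a ∈ S, ∃ y z, x = a + φ * y + c * z
  rep_unique : ∀ a ∈ S, ∀ b ∈ S, ∀ y z, a = b + φ * y + c * z → a = b

/-- The exponents `k` for which some `φ ^ k + c y` lies in `I`. -/
def resExponents {K : Type*} [CommRing K] (c φ : K) (I : Ideal K) : Set ℕ :=
  {k | ∃ y, φ ^ k + c * y ∈ I}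

/-- The exponents `k` for which `c φ ^ k` lies in `I`. -/
def torExponents {K : Type*} [CommRing K] (c φ : K) (I : Ideal K) : Set ℕ :=
  {k | c * φ ^ k ∈ I}

/-- `φ ^ t * G` is in normal form modulo `φ ^ b`: either `G = 0`, or `G` is a unit with an expansion
of length `b - t` in powers of `φ` with coefficients in `S`. -/
def IsNormalTail {K : Type*} [CommRing K] (φ : K) (S : Set K) (b t : ℕ) (G : K) : Prop :=
  (G = 0 ∧ t = 0) ∨
  (t < b ∧ IsUnit G ∧ ∃ a : ℕ → K, (∀ i, a i ∈ S) ∧ G = ∑ i ∈ Finset.range (b - t), a i * φ ^ i)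

/-- The data `(ω, μ, t, G)` of an ideal of type III or IV. -/
structure HasShape {K : Type*} [CommRing K] (c φ : K) (N : ℕ) (S : Set K) (I : Ideal K)
    (ω μ t : ℕ) (G : K) : Prop where
  pos : 0 < ω
  lt : ω < N
  le : μ ≤ ω
  res : IsLeast (resExponents c φ I) ω
  tor : IsLeast (torExponents c φ I) μ
  mem : φ ^ ω + c * (φ ^ t * G) ∈ I
  tail : IsNormalTail φ S μ t G

namespace IsLocalData

variable {K : Type*} [CommRing K] {c φ : K} {N : ℕ} {S : Set K}

lemma c_mul_self (h : IsLocalData c φ N S) : c * c = 0 := (h.mul_eq_zero_iff c).2 dvd_rfl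

lemma c_mul_pow (h : IsLocalData c φ N S) {k : ℕ} (hk : N ≤ k) : c * φ ^ k = 0 :=
  (h.mul_eq_zero_iff _).2 (h.dvd_pow.trans (pow_dvd_pow φ hk))

lemma isNilpotent_c (h : IsLocalData c φ N S) : IsNilpotent c := ⟨2, by rw [sq, h.c_mul_self]⟩

lemma isNilpotent_φ (h : IsLocalData c φ N S) : IsNilpotent φ := by
  refine ⟨N + N, ?_⟩
  obtain ⟨z, hz⟩ := h.dvd_pow
  rw [pow_add, hz, mul_mul_mul_comm, h.c_mul_self, zero_mul]

lemma isUnit_add (h : IsLocalData c φ N S) {u : K} (hu : IsUnit u) (y z : K) :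
    IsUnit (u + φ * y + c * z) := by
  have h1 : IsNilpotent (φ * y) := (Commute.all _ _).isNilpotent_mul_right h.isNilpotent_φ
  have h2 : IsNilpotent (c * z) := (Commute.all _ _).isNilpotent_mul_right h.isNilpotent_c
  have := (Commute.all _ _).isNilpotent_add h1 h2
  rw [add_assoc]
  exact this.isUnit_add_left_of_commute hu (Commute.all _ _)

lemma not_dvd_pow_mul_unit (h : IsLocalData c φ N S) {k : ℕ} (hk : k < N) {u : K}
    (hu : IsUnit u) : ¬ c ∣ φ ^ k * u := fun hd =>
  h.not_dvd_pow k hk (hu.dvd_mul_right.1 hd)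

/-- A non-unit is `φ y + c z`, so a factor `φ` can be split off again and again until a unit remains
or `φ ^ N` is reached. -/
lemma exists_eq_unit_mul_pow (h : IsLocalData c φ N S) (x : K) :
    ∃ k ≤ N, ∃ u y, IsUnit u ∧ x = u * φ ^ k + c * y := by
  suffices H : ∀ n, (∃ k ≤ n, ∃ u y, IsUnit u ∧ x = u * φ ^ k + c * y) ∨
      ∃ z y, x = z * φ ^ n + c * y by
    obtain ⟨k, hk, u, y, hu, hx⟩ | ⟨z, y, hx⟩ := H N
    · exact ⟨k, hk, u, y, hu, hx⟩
    · obtain ⟨w, hw⟩ := h.dvd_pow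
      -- Since `c` divides `φ ^ N`, the coefficient of `φ ^ N` may be changed to `1` at the cost of
      -- a multiple of `c`.
      exact ⟨N, le_rfl, 1, z * w + y - w, isUnit_one, by rw [hx, hw]; ring⟩
  intro n
  induction n with
  | zero => exact Or.inr ⟨x, 0, by simp⟩
  | succ n ih =>
    obtain ⟨k, hk, H⟩ | ⟨z, y, hx⟩ := ih
    · exact Or.inl ⟨k, by omega, H⟩
    · obtain hz | ⟨z1, z2, hz⟩ := h.isUnit_or z
      · exact Or.inl ⟨n, by omega, z, y, hz, hx⟩
      · exact Or.inr ⟨z1, z2 * φ ^ n + y, by rw [hx, hz]; ring⟩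

/-- Comparison of `φ`-adic orders modulo `c`: if `k < j`, moving everything to one side makes `c`
divide `φ ^ k` times a unit, although `k < N`. -/
lemma le_of_eq_add (h : IsLocalData c φ N S) {j k : ℕ} (hk : k < N) {u y z : K}
    (hu : IsUnit u) (e : φ ^ k * u = φ ^ j * y + c * z) : j ≤ k := by
  by_contra! hjk
  refine h.not_dvd_pow_mul_unit hk (h.isUnit_add hu (-(φ ^ (j - k - 1) * y)) 0) ⟨z, ?_⟩
  have : φ ^ j = φ ^ k * φ * φ ^ (j - k - 1) := by
    rw [← pow_succ, ← pow_add]; congr 1; omega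
  rw [this] at e
  linear_combination e

lemma c_mul_eq_iff (h : IsLocalData c φ N S) {x y : K} : c * x = c * y ↔ ∃ z, x = y + c * z := by
  rw [← sub_eq_zero, ← mul_sub, h.mul_eq_zero_iff]
  constructor
  · rintro ⟨z, hz⟩; exact ⟨z, by rw [← hz]; ring⟩
  · rintro ⟨z, hz⟩; exact ⟨z, by rw [hz]; ring⟩

lemma le_of_c_mul_eq (h : IsLocalData c φ N S) {j k : ℕ} (hk : k < N) {u y : K}
    (hu : IsUnit u) (e : c * (φ ^ k * u) = c * (φ ^ j * y)) : j ≤ k := by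
  obtain ⟨z, hz⟩ := h.c_mul_eq_iff.1 e
  exact h.le_of_eq_add hk hu hz

/-- Writing `x` as `u φ ^ k` modulo `c` gives `c φ ^ k ∈ I`, so `μ ≤ k`. -/
lemma dvd_of_c_mul_mem (h : IsLocalData c φ N S) {I : Ideal K} {μ : ℕ}
    (hμ : IsLeast (torExponents c φ I) μ) {x : K} (hx : c * x ∈ I) :
    ∃ z, c * x = c * φ ^ μ * z := by
  obtain ⟨k, -, u, y, hu, rfl⟩ := h.exists_eq_unit_mul_pow x
  have e : c * (u * φ ^ k + c * y) = u * (c * φ ^ k) := by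
    linear_combination y * h.c_mul_self
  rw [e] at hx ⊢
  have hk : μ ≤ k := hμ.2 ((Ideal.unit_mul_mem_iff_mem I hu).1 hx)
  refine ⟨u * φ ^ (k - μ), ?_⟩
  rw [← Nat.add_sub_of_le hk, pow_add, Nat.add_sub_cancel_left]
  ring

lemma exists_isLeast_tor (h : IsLocalData c φ N S) (I : Ideal K) :
    ∃ μ ≤ N, IsLeast (torExponents c φ I) μ := by
  have hN : N ∈ torExponents c φ I := by
    change c * φ ^ N ∈ I
    rw [h.c_mul_pow le_rfl]; exact I.zero_mem
  exact ⟨_, Nat.sInf_le hN, Nat.sInf_mem ⟨N, hN⟩, fun k hk => Nat.sInf_le hk⟩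

lemma exists_isLeast_res (h : IsLocalData c φ N S) (I : Ideal K) :
    ∃ ω ≤ N, IsLeast (resExponents c φ I) ω := by
  have hN : N ∈ resExponents c φ I := by
    obtain ⟨z, hz⟩ := h.dvd_pow
    exact ⟨-z, by rw [hz]; ring_nf; exact I.zero_mem⟩
  exact ⟨_, Nat.sInf_le hN, Nat.sInf_mem ⟨N, hN⟩, fun k hk => Nat.sInf_le hk⟩

/-- Multiplying `φ ^ ω + c y` by `c` kills the second term. This bounds the torsion exponent by the
residual one. -/
lemma mem_tor_of_mem_res (h : IsLocalData c φ N S) {I : Ideal K} {ω : ℕ}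
    (hω : ω ∈ resExponents c φ I) : ω ∈ torExponents c φ I := by
  obtain ⟨y, hy⟩ := hω
  have := I.mul_mem_left c hy
  rwa [mul_add, ← mul_assoc c c, h.c_mul_self, zero_mul, add_zero] at this

/-- An ideal is generated by any of its elements `φ ^ ω + c y` with `ω` least, and by the
`c φ ^ μ` with `μ` least. -/
lemma eq_span_pair (h : IsLocalData c φ N S) {I : Ideal K} {ω μ : ℕ}
    (hω : IsLeast (resExponents c φ I) ω) (hμ : IsLeast (torExponents c φ I) μ) {y : K}
    (hy : φ ^ ω + c * y ∈ I) : I = Ideal.span {φ ^ ω + c * y, c * φ ^ μ} := by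
  apply le_antisymm
  · intro x hx
    obtain ⟨k, -, u, w, hu, rfl⟩ := h.exists_eq_unit_mul_pow x
    obtain ⟨v, hv⟩ := hu.exists_left_inv
    have hk : ω ≤ k := hω.2 ⟨v * w, by
      have := I.mul_mem_left v hx
      rwa [show v * (u * φ ^ k + c * w) = φ ^ k + c * (v * w) by
        linear_combination φ ^ k * hv] at this⟩
    have e : u * φ ^ k + c * w - u * φ ^ (k - ω) * (φ ^ ω + c * y)
        = c * (w - u * φ ^ (k - ω) * y) := by
      rw [← Nat.add_sub_of_le hk, pow_add, Nat.add_sub_cancel_left]; ring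
    have hm : c * (w - u * φ ^ (k - ω) * y) ∈ I := e ▸ I.sub_mem hx (I.mul_mem_left _ hy)
    obtain ⟨z, hz⟩ := h.dvd_of_c_mul_mem hμ hm
    rw [Ideal.mem_span_pair]
    exact ⟨u * φ ^ (k - ω), z, by linear_combination hz.symm - e⟩
  · rw [Ideal.span_le, Set.insert_subset_iff, Set.singleton_subset_iff]
    exact ⟨hy, hμ.1⟩

/-- Modulo `c` the upper bound on `I` is generated by `φ ^ ω`, so no smaller power of `φ` occurs. -/
lemma isLeast_res_of_le (h : IsLocalData c φ N S) {I : Ideal K} {ω : ℕ} (hω : ω ≤ N) {y x : K}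
    (hy : φ ^ ω + c * y ∈ I) (hI : I ≤ Ideal.span {φ ^ ω + c * y, c * x}) :
    IsLeast (resExponents c φ I) ω := by
  refine ⟨⟨y, hy⟩, ?_⟩
  rintro k ⟨z, hz⟩
  obtain ⟨A, B, e⟩ := Ideal.mem_span_pair.1 (hI hz)
  by_contra! hk
  have := h.le_of_eq_add (j := ω) (k := k) (u := 1) (y := A) (z := A * y + B * x - z)
    (by omega) isUnit_one (by linear_combination -e)
  omega

/-- If `c φ ^ k` lies in the pair ideal, subtracting a multiple of `c φ ^ μ` leaves torsion of the
principal ideal, a multiple of `c φ ^ κ`. As `μ ≤ κ`, everything is a multiple of `c φ ^ μ`. -/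
lemma isLeast_tor_span_pair (h : IsLocalData c φ N S) {ω μ κ : ℕ} {y : K}
    (hκ : IsLeast (torExponents c φ (Ideal.span {φ ^ ω + c * y})) κ) (hμκ : μ ≤ κ) (hμ : μ ≤ N) :
    IsLeast (torExponents c φ (Ideal.span {φ ^ ω + c * y, c * φ ^ μ})) μ := by
  refine ⟨Ideal.subset_span (by simp), fun k hk => ?_⟩
  obtain ⟨A, B, e⟩ := Ideal.mem_span_pair.1 hk
  have hm : c * (φ ^ k - B * φ ^ μ) ∈ Ideal.span {φ ^ ω + c * y} :=
    Ideal.mem_span_singleton'.2 ⟨A, by linear_combination e⟩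
  obtain ⟨z, hz⟩ := h.dvd_of_c_mul_mem hκ hm
  by_contra! hkμ
  have := h.le_of_c_mul_eq (j := μ) (k := k) (u := 1) (y := B + φ ^ (κ - μ) * z)
    (by omega) isUnit_one (by
      rw [← Nat.add_sub_of_le hμκ, pow_add] at hz
      linear_combination hz)
  omega

lemma isLeast_res_c_mul (h : IsLocalData c φ N S) (x : K) :
    IsLeast (resExponents c φ (Ideal.span {c * x})) N := by
  obtain ⟨w, hw⟩ := h.dvd_pow
  refine ⟨⟨-w, by rw [hw]; ring_nf; exact Ideal.zero_mem _⟩, ?_⟩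
  rintro k ⟨z, hz⟩
  obtain ⟨A, e⟩ := Ideal.mem_span_singleton'.1 hz
  by_contra! hk
  exact h.not_dvd_pow k hk ⟨A * x - z, by linear_combination -e⟩

lemma isLeast_tor_c_mul (h : IsLocalData c φ N S) {μ : ℕ} (hμ : μ ≤ N) :
    IsLeast (torExponents c φ (Ideal.span {c * φ ^ μ})) μ := by
  refine ⟨Ideal.subset_span rfl, fun k hk => ?_⟩
  obtain ⟨A, e⟩ := Ideal.mem_span_singleton'.1 hk
  by_contra! hkμ
  have := h.le_of_c_mul_eq (j := μ) (k := k) (u := 1) (y := A)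
    (by omega) isUnit_one (by linear_combination -e)
  omega

lemma exists_expansion (h : IsLocalData c φ N S) (x : K) (n : ℕ) :
    ∃ a : ℕ → K, (∀ i, a i ∈ S) ∧ ∃ y z, x = ∑ i ∈ Finset.range n, a i * φ ^ i + φ ^ n * y + c * z := by
  induction n generalizing x with
  | zero => exact ⟨fun _ => 0, fun _ => h.zero_mem, x, 0, by simp⟩
  | succ n ih =>
    obtain ⟨a, ha, y, z, hx⟩ := h.exists_rep x
    obtain ⟨b, hb, y', z', hy⟩ := ih y
    refine ⟨fun i => Nat.casesOn i a b, fun i => by cases i <;> simp [ha, hb],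
      y', φ * z' + z, ?_⟩
    rw [Finset.sum_range_succ', hx, hy]
    simp only [pow_succ, ← mul_assoc, ← Finset.sum_mul]
    change _ = _ + a * φ ^ 0 + _ + _
    ring

lemma isUnit_sub (h : IsLocalData c φ N S) {a b : K} (ha : a ∈ S) (hb : b ∈ S) (hab : a ≠ b) :
    IsUnit (a - b) := by
  obtain hu | ⟨y, z, e⟩ := h.isUnit_or (a - b)
  · exact hu
  · exact absurd (h.rep_unique a ha b hb y z (by linear_combination e)) hab

lemma isUnit_sum (h : IsLocalData c φ N S) {a : ℕ → K} {n : ℕ} (hn : 0 < n) (ha : IsUnit (a 0)) :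
    IsUnit (∑ i ∈ Finset.range n, a i * φ ^ i) := by
  obtain ⟨n, rfl⟩ := Nat.exists_eq_add_of_lt hn
  rw [zero_add, Finset.sum_range_succ']
  simp only [pow_succ, ← mul_assoc, ← Finset.sum_mul, pow_zero, mul_one]
  convert h.isUnit_add ha (∑ i ∈ Finset.range n, a (i + 1) * φ ^ i) 0 using 1
  ring

/-- The prefactor `φ ^ t` is there for the induction: cancelling the equal leading digits turns it
into `φ ^ (t + 1)`. -/
lemma expansion_unique (h : IsLocalData c φ N S) {a b : ℕ → K} (ha : ∀ i, a i ∈ S)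
    (hb : ∀ i, b i ∈ S) (t n : ℕ) (hn : t + n ≤ N) {y z : K}
    (e : φ ^ t * ∑ i ∈ Finset.range n, a i * φ ^ i =
      φ ^ t * ∑ i ∈ Finset.range n, b i * φ ^ i + φ ^ (t + n) * y + c * z) :
    ∀ i < n, a i = b i := by
  induction n generalizing a b t with
  | zero => intro i hi; omega
  | succ n ih =>
    rw [Finset.sum_range_succ', Finset.sum_range_succ'] at e
    simp only [pow_succ, ← mul_assoc, ← Finset.sum_mul, pow_zero, mul_one] at e
    -- Distinct digits differ by a unit, so the left side would have order exactly `t` and the right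
    -- side order at least `t + 1`.
    have h0 : a 0 = b 0 := by
      by_contra hab
      have := h.le_of_eq_add (j := t + 1) (k := t) (z := z)
        (y := ∑ i ∈ Finset.range n, b (i + 1) * φ ^ i - ∑ i ∈ Finset.range n, a (i + 1) * φ ^ i
          + φ ^ n * y)
        (by omega) (h.isUnit_sub (ha 0) (hb 0) hab) (by
          rw [pow_succ]; rw [← add_assoc, pow_succ, pow_add] at e
          linear_combination e)
      omega
    have hs := ih (a := fun i => a (i + 1)) (b := fun i => b (i + 1)) (fun i => ha _)
      (fun i => hb _) (t + 1) (by omega) (by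
        rw [h0] at e
        rw [pow_succ, add_right_comm t 1 n]
        rw [add_assoc] at *
        linear_combination e)
    intro i hi
    cases i with
    | zero => exact h0
    | succ i => exact hs i (by omega)

/-- Expand `x` to `b` digits. A zero leading digit lets one factor `φ` move into `φ ^ t` and lowers
`b`; a nonzero one makes the sum a unit. -/
lemma exists_normalTail (h : IsLocalData c φ N S) (x : K) (b : ℕ) :
    ∃ t G, IsNormalTail φ S b t G ∧ ∃ w, c * x = c * (φ ^ t * G) + c * φ ^ b * w := by
  induction b generalizing x with
  | zero => exact ⟨0, 0, Or.inl ⟨rfl, rfl⟩, x, by simp⟩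
  | succ b ih =>
    obtain ⟨a, ha, y, z, hx⟩ := h.exists_expansion x (b + 1)
    by_cases h0 : a 0 = 0
    · rw [Finset.sum_range_succ', h0] at hx
      simp only [pow_succ, ← mul_assoc, ← Finset.sum_mul, zero_mul, add_zero] at hx
      obtain ⟨t, G, hG, w, hw⟩ := ih (∑ i ∈ Finset.range b, a (i + 1) * φ ^ i)
      have e : c * x = c * (φ ^ (t + 1) * G) + c * φ ^ (b + 1) * (w + y) := by
        rw [hx]
        linear_combination φ * hw + z * h.c_mul_self
      obtain ⟨rfl, rfl⟩ | ⟨ht, hu, a', ha', rfl⟩ := hG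
      -- A zero tail carries `t = 0` by convention, so the exponent is not raised here.
      · exact ⟨0, 0, Or.inl ⟨rfl, rfl⟩, w + y, by rw [e]; ring⟩
      · refine ⟨t + 1, _, Or.inr ⟨by omega, hu, a', ha', ?_⟩, w + y, e⟩
        rw [Nat.add_sub_add_right]
    · refine ⟨0, _, Or.inr ⟨by omega, h.isUnit_sum (Nat.succ_pos b) ?_, a, ha, rfl⟩, y, ?_⟩
      · simpa using h.isUnit_sub (ha 0) h.zero_mem h0
      · rw [hx]
        change _ = c * (φ ^ 0 * ∑ i ∈ Finset.range (b + 1), a i * φ ^ i) + _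
        linear_combination z * h.c_mul_self

/-- A nonzero tail has order exactly `t < b` modulo `c`, which separates it from `0` and fixes `t`;
then uniqueness of digits applies. -/
lemma normalTail_unique (h : IsLocalData c φ N S) {b t t' : ℕ} {G G' : K} (hb : b ≤ N)
    (hG : IsNormalTail φ S b t G) (hG' : IsNormalTail φ S b t' G') {w : K}
    (e : c * (φ ^ t * G) = c * (φ ^ t' * G') + c * φ ^ b * w) : t = t' ∧ G = G' := by
  obtain ⟨rfl, rfl⟩ | ⟨ht, hu, a, ha, hs⟩ := hG <;>
    obtain ⟨rfl, rfl⟩ | ⟨ht', hu', a', ha', hs'⟩ := hG'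
  · exact ⟨rfl, rfl⟩
  · have := h.le_of_c_mul_eq (j := b) (k := t') (y := -w) (by omega) hu' (by linear_combination -e)
    omega
  · have := h.le_of_c_mul_eq (j := b) (k := t) (y := w) (by omega) hu (by linear_combination e)
    omega
  · have key : ∀ {t t' : ℕ} {G G' w : K}, t < b → IsUnit G →
        c * (φ ^ t * G) = c * (φ ^ t' * G') + c * φ ^ b * w → t' ≤ t := by
      intro t t' G G' w ht hu e
      by_contra! htt
      have := h.le_of_c_mul_eq (j := t + 1) (k := t) (y := φ ^ (t' - t - 1) * G' + φ ^ (b - t - 1) * w)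
        (by omega) hu (by
          rw [e, mul_add (φ ^ (t + 1)), ← mul_assoc (φ ^ (t + 1)), ← mul_assoc (φ ^ (t + 1)),
            ← pow_add, ← pow_add, show t + 1 + (t' - t - 1) = t' by omega,
            show t + 1 + (b - t - 1) = b by omega]
          ring)
      omega
    obtain rfl : t = t' := le_antisymm
      (key (G' := G) (w := -w) ht' hu' (by linear_combination -e)) (key ht hu e)
    refine ⟨rfl, ?_⟩
    obtain ⟨z, hz⟩ := h.c_mul_eq_iff.1 (e.trans (show _ = c * (φ ^ t * G' + φ ^ b * w) by ring))
    have := h.expansion_unique ha ha' t (b - t) (by omega) (y := w) (z := z) (by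
      rw [← hs, ← hs', Nat.add_sub_of_le ht.le, hz])
    rw [hs, hs']
    exact Finset.sum_congr rfl fun i hi => by rw [this i (Finset.mem_range.1 hi)]

/-- The exponents are least elements of sets attached to `I`. The difference of the two lifts lies
in `I ∩ cK`, hence is a multiple of `c φ ^ μ`, and the tails agree. -/
lemma shape_unique (h : IsLocalData c φ N S) {I : Ideal K} {ω μ t ω' μ' t' : ℕ} {G G' : K}
    (h1 : HasShape c φ N S I ω μ t G) (h2 : HasShape c φ N S I ω' μ' t' G') :
    ω = ω' ∧ μ = μ' ∧ t = t' ∧ G = G' := by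
  obtain rfl := h1.res.unique h2.res
  obtain rfl := h1.tor.unique h2.tor
  have hm : c * (φ ^ t * G - φ ^ t' * G') ∈ I := by
    convert I.sub_mem h1.mem h2.mem using 1; ring
  obtain ⟨w, hw⟩ := h.dvd_of_c_mul_mem h1.tor hm
  exact ⟨rfl, rfl, h.normalTail_unique (h1.le.trans h1.lt.le) h1.tail h2.tail
    (w := w) (by linear_combination hw)⟩

end IsLocalData

end ChainCode

/-! ### Reduction modulo `γ`, and the local structure of the components. -/

namespace ChainCode

/-- `π` is the reduction of `R` modulo `γ`, and the annihilator of `γ` is generated by `γ`. -/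
structure IsReduction {R F : Type*} [CommRing R] [Field F] (γ : R) (π : R →+* F) : Prop where
  surjective : Function.Surjective π
  map_eq_zero_iff : ∀ x, π x = 0 ↔ γ ∣ x
  mul_eq_zero_iff : ∀ x, γ * x = 0 ↔ γ ∣ x

namespace IsReduction

variable {R F : Type*} [CommRing R] [Field F] {γ : R} {π : R →+* F}

lemma map_self (h : IsReduction γ π) : π γ = 0 := (h.map_eq_zero_iff γ).2 dvd_rfl

lemma mul_self (h : IsReduction γ π) : γ * γ = 0 := (h.mul_eq_zero_iff γ).2 dvd_rfl

lemma C_mul_C (h : IsReduction γ π) : (C γ * C γ : R[X]) = 0 := by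
  rw [← C_mul, h.mul_self, C_0]

lemma poly_map_eq_zero_iff (h : IsReduction γ π) (P : R[X]) : P.map π = 0 ↔ C γ ∣ P := by
  rw [C_dvd_iff_dvd_coeff, Polynomial.ext_iff]
  simp [h.map_eq_zero_iff]

lemma poly_map_eq_iff (h : IsReduction γ π) (P Q : R[X]) :
    P.map π = Q.map π ↔ ∃ z, P = Q + C γ * z := by
  rw [← sub_eq_zero, ← Polynomial.map_sub, h.poly_map_eq_zero_iff]
  constructor
  · rintro ⟨z, hz⟩; exact ⟨z, by rw [← hz]; ring⟩
  · rintro ⟨z, hz⟩; exact ⟨z, by rw [hz]; ring⟩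

lemma C_mul_eq_zero_iff (h : IsReduction γ π) (P : R[X]) : C γ * P = 0 ↔ C γ ∣ P := by
  rw [C_dvd_iff_dvd_coeff, Polynomial.ext_iff]
  simp [h.mul_eq_zero_iff]

lemma exists_poly_map_eq (h : IsReduction γ π) (P : F[X]) : ∃ Q : R[X], Q.map π = P :=
  Polynomial.map_surjective π h.surjective P

/-- The quotient `R[X] ⧸ ⟨f ^ N + γ g⟩` with `f` monic and irreducible modulo `γ`. -/
lemma isLocalData (h : IsReduction γ π) {f g : R[X]} {N : ℕ} (hN : 0 < N) (hf : f.Monic)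
    (hirr : Irreducible (f.map π)) {T : Set R} (hT0 : 0 ∈ T)
    (hT : Set.BijOn π T Set.univ) :
    IsLocalData (cls γ N f g (C γ)) (cls γ N f g f) N
      (cls γ N f g '' polysLT T f.natDegree) := by
  have hrel : cls γ N f g f ^ N = -(cls γ N f g (C γ) * cls γ N f g g) := by
    rw [eq_neg_iff_add_eq_zero, ← map_pow, ← map_mul, ← map_add]
    exact Ideal.Quotient.eq_zero_iff_mem.2 (Ideal.mem_span_singleton_self _)
  have hcc : cls γ N f g (C γ) * cls γ N f g (C γ) = 0 := by
    rw [← map_mul, h.C_mul_C, map_zero]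
  have hsurj : Function.Surjective (cls γ N f g) := Ideal.Quotient.mk_surjective
  have hγ : (C γ).map π = 0 := by rw [map_C, h.map_self, C_0]
  have hzero : ∀ P, cls γ N f g P = 0 → ∃ w, P = (f ^ N + C γ * g) * w := fun P hP => by
    obtain ⟨w, hw⟩ := Ideal.mem_span_singleton.1 (Ideal.Quotient.eq_zero_iff_mem.1 hP)
    exact ⟨w, hw⟩
  have hfN : f.map π ^ N ≠ 0 := pow_ne_zero _ hirr.ne_zero
  refine ⟨?_, ?_, ?_, ?_, ?_, ?_, ?_⟩
  · intro x
    constructor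
    · obtain ⟨P, rfl⟩ := hsurj x
      intro hP
      rw [← map_mul] at hP
      obtain ⟨w, hw⟩ := hzero _ hP
      -- Modulo `γ` the equation reads `0 = f ^ N * w` in the domain `F[X]`.
      have hw0 : w.map π = 0 := by
        have := congrArg (Polynomial.map π) hw
        simp only [Polynomial.map_mul, Polynomial.map_add, Polynomial.map_pow, hγ, zero_mul,
          add_zero] at this
        exact (mul_eq_zero.1 this.symm).resolve_left hfN
      obtain ⟨v, rfl⟩ := (h.poly_map_eq_zero_iff w).1 hw0
      have : C γ * (P - f ^ N * v) = 0 := by linear_combination hw + g * v * h.C_mul_C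
      obtain ⟨u, hu⟩ := (h.C_mul_eq_zero_iff _).1 this
      rw [sub_eq_iff_eq_add.1 hu, map_add, map_mul, map_mul, map_pow, hrel]
      exact ⟨cls γ N f g u - cls γ N f g g * cls γ N f g v, by ring⟩
    · rintro ⟨y, rfl⟩
      rw [← mul_assoc, hcc, zero_mul]
  · intro x
    obtain ⟨P, rfl⟩ := hsurj x
    by_cases hd : f.map π ∣ P.map π
    · right
      obtain ⟨q, hq⟩ := hd
      obtain ⟨Q, rfl⟩ := h.exists_poly_map_eq q
      rw [← Polynomial.map_mul, h.poly_map_eq_iff] at hq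
      obtain ⟨z, rfl⟩ := hq
      exact ⟨cls γ N f g Q, cls γ N f g z, by simp only [map_add, map_mul]⟩
    · left
      -- A Bézout relation modulo `γ` shows that `B P` is `1` plus a nilpotent element.
      obtain ⟨a, b, hab⟩ := (hirr.coprime_iff_not_dvd.2 hd)
      obtain ⟨A, rfl⟩ := h.exists_poly_map_eq a
      obtain ⟨B, rfl⟩ := h.exists_poly_map_eq b
      rw [← Polynomial.map_mul, ← Polynomial.map_mul, ← Polynomial.map_add,
        ← Polynomial.map_one π, h.poly_map_eq_iff] at hab
      obtain ⟨z, hz⟩ := hab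
      have e := congrArg (cls γ N f g) hz
      simp only [map_add, map_mul, map_one] at e
      have hn : IsNilpotent (cls γ N f g (C γ) * cls γ N f g z - cls γ N f g A * cls γ N f g f) := by
        refine (Commute.all _ _).isNilpotent_sub ?_ ?_
        · exact (Commute.all _ _).isNilpotent_mul_right ⟨2, by rw [sq, hcc]⟩
        · refine (Commute.all _ _).isNilpotent_mul_left ⟨N + N, ?_⟩
          rw [pow_add, hrel]
          linear_combination cls γ N f g g ^ 2 * hcc
      have := hn.isUnit_one_add
      rw [show 1 + (cls γ N f g (C γ) * cls γ N f g z - cls γ N f g A * cls γ N f g f)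
        = cls γ N f g B * cls γ N f g P by linear_combination -e] at this
      exact isUnit_of_mul_isUnit_right this
  · rw [hrel]; exact ⟨-cls γ N f g g, by ring⟩
  · rintro k hk ⟨x, hx⟩
    obtain ⟨P, rfl⟩ := hsurj x
    rw [← sub_eq_zero, ← map_pow, ← map_mul, ← map_sub] at hx
    obtain ⟨w, hw⟩ := hzero _ hx
    have := congrArg (Polynomial.map π) hw
    simp only [Polynomial.map_mul, Polynomial.map_add, Polynomial.map_sub, Polynomial.map_pow, hγ,
      zero_mul, add_zero, sub_zero] at this
    have hdvd : f.map π ^ N ∣ f.map π ^ k := ⟨_, this⟩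
    have := (pow_dvd_pow_iff hirr.ne_zero hirr.not_isUnit).1 hdvd
    omega
  · exact ⟨0, ⟨by simp [bot_lt_iff_ne_bot], by simpa using hT0⟩, map_zero _⟩
  · intro x
    obtain ⟨P, rfl⟩ := hsurj x
    -- `r` picks the representative in `T` of each residue. As `r 0 = 0`, replacing the coefficients
    -- of the remainder by representatives keeps its degree below that of `f`.
    choose r hrT hr using fun x : F => hT.surjOn (Set.mem_univ x)
    have hr0 : r 0 = 0 := hT.injOn (hrT 0) hT0 (by rw [hr, map_zero])
    set Q := P %ₘ f with hQ
    have hnt : Nontrivial R := π.domain_nontrivial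
    have hf1 : f ≠ 1 := by rintro rfl; exact hirr.not_isUnit (by simp)
    have hQd : Q.natDegree < f.natDegree := natDegree_modByMonic_lt P hf hf1
    set a : R[X] := ∑ i ∈ Finset.range f.natDegree, C (r (π (Q.coeff i))) * X ^ i with ha
    have hac : ∀ i, a.coeff i = r (π (Q.coeff i)) := by
      intro i
      rw [ha, finsetSum_coeff]
      simp only [coeff_C_mul_X_pow]
      rw [Finset.sum_ite_eq]
      split_ifs with hi
      · rfl
      · rw [coeff_eq_zero_of_natDegree_lt (by rw [Finset.mem_range] at hi; omega), map_zero, hr0]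
    have hmap : Q.map π = a.map π := by
      ext i; rw [coeff_map, coeff_map, hac, hr]
    obtain ⟨z, hz⟩ := (h.poly_map_eq_iff _ _).1 hmap
    refine ⟨_, ⟨a, ⟨?_, fun i => ?_⟩, rfl⟩, cls γ N f g (P /ₘ f), cls γ N f g z, ?_⟩
    · rw [degree_lt_iff_coeff_zero]
      intro i hi
      rw [hac, coeff_eq_zero_of_natDegree_lt (by omega), map_zero, hr0]
    · rw [hac]; exact hrT _
    · rw [← map_mul, ← map_mul, ← map_add, ← map_add]
      congr 1
      conv_lhs => rw [← modByMonic_add_div P f, ← hQ, hz]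
      ring
  · rintro _ ⟨a, ha, rfl⟩ _ ⟨b, hb, rfl⟩ y z e
    obtain ⟨y, rfl⟩ := hsurj y
    obtain ⟨z, rfl⟩ := hsurj z
    rw [← sub_eq_zero, ← map_mul, ← map_mul, ← map_add, ← map_add, ← map_sub] at e
    obtain ⟨w, hw⟩ := hzero _ e
    have hw := congrArg (Polynomial.map π) hw
    simp only [Polynomial.map_mul, Polynomial.map_add, Polynomial.map_sub, Polynomial.map_pow, hγ,
      zero_mul, add_zero] at hw
    -- Since `0 < N`, the modulus vanishes modulo `f` and `γ`; the degree bound then forces `a = b`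
    -- modulo `γ`, and injectivity on `T` finishes.
    have hd : f.map π ∣ (a - b).map π := by
      refine ⟨y.map π + f.map π ^ (N - 1) * w.map π, ?_⟩
      rw [Polynomial.map_sub, mul_add, ← mul_assoc, ← pow_succ', Nat.sub_add_cancel (by omega)]
      linear_combination hw
    have hlt : ((a - b).map π).degree < (f.map π).degree := by
      have hnt : Nontrivial R := π.domain_nontrivial
      rw [hf.degree_map, degree_eq_natDegree hf.ne_zero]
      exact degree_map_le.trans_lt ((degree_sub_le _ _).trans_lt (max_lt ha.1 hb.1))
    have h0 := eq_zero_of_dvd_of_degree_lt hd hlt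
    congr 1
    ext i
    refine hT.injOn (ha.2 i) (hb.2 i) ?_
    have := congrArg (fun P => P.coeff i) h0
    simpa [sub_eq_zero] using this

end IsReduction

section

variable {R : Type*} [CommRing R] {γ : R} {N : ℕ} {f g : R[X]} {T : Set R}

lemma isTail_iff {b t : ℕ} {G : LocalComponent γ N f g} :
    IsTail γ N f g T b t G ↔
      IsNormalTail (cls γ N f g f) (cls γ N f g '' polysLT T f.natDegree) b t G := by
  refine or_congr_right (and_congr_right fun _ => and_congr_right fun _ => ?_)
  constructor
  · rintro ⟨a, ha, e⟩
    exact ⟨fun i => cls γ N f g (a i), fun i => ⟨a i, ha i, rfl⟩, e⟩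
  · rintro ⟨a, ha, e⟩
    choose a' ha' h using ha
    exact ⟨a', ha', by simp only [h, e]⟩

lemma gen_eq (ω t : ℕ) (G : LocalComponent γ N f g) :
    gen γ N f g ω t G = cls γ N f g f ^ ω + cls γ N f g (C γ) * (cls γ N f g f ^ t * G) := by
  rw [gen, mul_assoc]

end

end ChainCode

/-! ### The list of ideals is complete and without repetition. -/

namespace ChainCode

section

variable {R : Type*} [CommRing R] {γ : R} {N : ℕ} {f g : R[X]} {T : Set R}

local notation "φf" => cls γ N f g f
local notation "cγ" => cls γ N f g (C γ)
local notation "Sf" => cls γ N f g '' polysLT T f.natDegree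

lemma toIdeal_typeIII (ω t : ℕ) (G : LocalComponent γ N f g) :
    Entry.toIdeal γ N f g (.typeIII ω t G) = Ideal.span {φf ^ ω + cγ * (φf ^ t * G)} := by
  rw [← gen_eq]; rfl

lemma toIdeal_typeIV (ω μ t : ℕ) (G : LocalComponent γ N f g) :
    Entry.toIdeal γ N f g (.typeIV ω μ t G) =
      Ideal.span {φf ^ ω + cγ * (φf ^ t * G), cγ * φf ^ μ} := by
  rw [← gen_eq]; rfl

lemma torsionExponents_eq (ω t : ℕ) (G : LocalComponent γ N f g) :
    torsionExponents γ N f g ω t G =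
      torExponents cγ φf (Ideal.span {φf ^ ω + cγ * (φf ^ t * G)}) := by
  rw [← gen_eq]; rfl

lemma IsLocalData.hasShape_typeIII (h : IsLocalData cγ φf N Sf) {ω t : ℕ}
    {G : LocalComponent γ N f g} (hE : Entry.IsListed γ N f g T (.typeIII ω t G)) :
    ∃ κ, IsLeast (torsionExponents γ N f g ω t G) κ ∧
      HasShape cγ φf N Sf (Entry.toIdeal γ N f g (.typeIII ω t G)) ω κ t G := by
  obtain ⟨h0, hN, κ, hκ, ht⟩ := hE
  -- Dropping the side condition `k ≤ ω` does not change the minimum: a smaller exponent would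
  -- satisfy it anyway.
  have hκ' : IsLeast (torsionExponents γ N f g ω t G) κ := by
    refine ⟨hκ.1.2, fun k hk => ?_⟩
    by_contra! hkκ
    have := hκ.2 ⟨hkκ.le.trans hκ.1.1, hk⟩
    omega
  refine ⟨κ, hκ', h0, hN, hκ.1.1, ?_, ?_, ?_, isTail_iff.1 ht⟩
  · rw [toIdeal_typeIII]
    exact h.isLeast_res_of_le hN.le (x := 0) (Ideal.subset_span rfl)
      (Ideal.span_mono (by simp))
  · rw [toIdeal_typeIII]; rwa [torsionExponents_eq] at hκ'
  · rw [toIdeal_typeIII]; exact Ideal.subset_span rfl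

lemma IsLocalData.hasShape_typeIV (h : IsLocalData cγ φf N Sf) {ω μ t : ℕ}
    {G : LocalComponent γ N f g} (hE : Entry.IsListed γ N f g T (.typeIV ω μ t G)) :
    HasShape cγ φf N Sf (Entry.toIdeal γ N f g (.typeIV ω μ t G)) ω μ t G := by
  obtain ⟨hN, κ, hκ, hμ, hκω, ht⟩ := hE
  rw [torsionExponents_eq] at hκ
  -- For Type IV, `0 < ω` comes from `μ < κ ≤ ω`.
  refine ⟨by omega, hN, by omega, ?_, ?_, ?_, isTail_iff.1 ht⟩
  · rw [toIdeal_typeIV]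
    exact h.isLeast_res_of_le hN.le (Ideal.subset_span (by simp)) le_rfl
  · rw [toIdeal_typeIV]
    exact h.isLeast_tor_span_pair hκ hμ.le (by omega)
  · rw [toIdeal_typeIV]; exact Ideal.subset_span (by simp)

lemma IsLocalData.isLeast_res_zero (h : IsLocalData cγ φf N Sf) :
    IsLeast (resExponents cγ φf (Entry.toIdeal γ N f g .zero)) N := by
  have := h.isLeast_res_c_mul 0
  rw [mul_zero, Ideal.span_singleton_zero] at this
  exact this

lemma IsLocalData.isLeast_tor_zero (h : IsLocalData cγ φf N Sf) :
    IsLeast (torExponents cγ φf (Entry.toIdeal γ N f g .zero)) N := by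
  have := h.isLeast_tor_c_mul le_rfl
  rw [h.c_mul_pow le_rfl, Ideal.span_singleton_zero] at this
  exact this

lemma isLeast_res_whole :
    IsLeast (resExponents cγ φf (Entry.toIdeal γ N f g .whole)) 0 :=
  ⟨⟨0, Submodule.mem_top⟩, fun _ _ => Nat.zero_le _⟩

/-- The residual exponent is `0` for the whole ring, `N` for the zero ideal and Type II, and
strictly between for Types III and IV. The torsion exponent separates zero (`N`) from Type II (`τ <
N`). A coincidence of Types III and IV would give `μ = κ`. -/
lemma IsLocalData.toIdeal_injOn (h : IsLocalData cγ φf N Sf) (hN : 0 < N) :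
    Set.InjOn (Entry.toIdeal γ N f g) {E | Entry.IsListed γ N f g T E} := by
  have key3 : ∀ {ω t G}, Entry.IsListed γ N f g T (.typeIII ω t G) →
      ∀ {k}, IsLeast (resExponents cγ φf (Entry.toIdeal γ N f g (.typeIII ω t G))) k →
      0 < k ∧ k < N := by
    intro ω t G hE k hk
    obtain ⟨κ, -, hs⟩ := h.hasShape_typeIII hE
    rw [hk.unique hs.res]; exact ⟨hs.pos, hs.lt⟩
  have key4 : ∀ {ω μ t G}, Entry.IsListed γ N f g T (.typeIV ω μ t G) →
      ∀ {k}, IsLeast (resExponents cγ φf (Entry.toIdeal γ N f g (.typeIV ω μ t G))) k →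
      0 < k ∧ k < N := by
    intro ω μ t G hE k hk
    have hs := h.hasShape_typeIV hE
    rw [hk.unique hs.res]; exact ⟨hs.pos, hs.lt⟩
  have key34 : ∀ {ω t G ω' μ' t' G'}, Entry.IsListed γ N f g T (.typeIII ω t G) →
      Entry.IsListed γ N f g T (.typeIV ω' μ' t' G') →
      Entry.toIdeal γ N f g (.typeIII ω t G) ≠ Entry.toIdeal γ N f g (.typeIV ω' μ' t' G') := by
    intro ω t G ω' μ' t' G' hE hE' e
    obtain ⟨κ, hκ, hs⟩ := h.hasShape_typeIII hE
    rw [e] at hs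
    obtain ⟨rfl, rfl, rfl, rfl⟩ := h.shape_unique hs (h.hasShape_typeIV hE')
    obtain ⟨-, κ', hκ', hlt, -⟩ := hE'
    exact hlt.ne (hκ.unique hκ')
  have res2 : ∀ τ, IsLeast (resExponents cγ φf (Entry.toIdeal γ N f g (.typeII τ))) N :=
    fun τ => h.isLeast_res_c_mul _
  have tor2 : ∀ {τ}, τ < N →
      IsLeast (torExponents cγ φf (Entry.toIdeal γ N f g (.typeII τ))) τ :=
    fun hτ => h.isLeast_tor_c_mul hτ.le
  have res0 := h.isLeast_res_zero
  have tor0 := h.isLeast_tor_zero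
  have res1 := isLeast_res_whole (γ := γ) (N := N) (f := f) (g := g)
  have hlt : ∀ {a b : ℕ}, a < b → b = a → False := by intros; omega
  intro E hE E' hE' e
  cases E with
  | zero =>
    cases E' with
    | zero => rfl
    | whole => exact (hlt hN (res0.unique (e ▸ res1))).elim
    | typeII τ' => exact (hlt hE' (tor0.unique (e ▸ tor2 hE'))).elim
    | typeIII ω' t' G' => exact ((key3 hE' (e ▸ res0)).2.ne rfl).elim
    | typeIV ω' μ' t' G' => exact ((key4 hE' (e ▸ res0)).2.ne rfl).elim
  | whole =>
    cases E' with
    | zero => exact (hlt hN (res0.unique (e ▸ res1))).elim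
    | whole => rfl
    | typeII τ' => exact (hlt hN ((res2 τ').unique (e ▸ res1))).elim
    | typeIII ω' t' G' => exact ((key3 hE' (e ▸ res1)).1.ne rfl).elim
    | typeIV ω' μ' t' G' => exact ((key4 hE' (e ▸ res1)).1.ne rfl).elim
  | typeII τ =>
    cases E' with
    | zero => exact (hlt hE (tor0.unique (e ▸ tor2 hE))).elim
    | whole => exact (hlt hN ((res2 τ).unique (e ▸ res1))).elim
    | typeII τ' => rw [(tor2 hE).unique (e ▸ tor2 hE')]
    | typeIII ω' t' G' => exact ((key3 hE' (e ▸ res2 τ)).2.ne rfl).elim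
    | typeIV ω' μ' t' G' => exact ((key4 hE' (e ▸ res2 τ)).2.ne rfl).elim
  | typeIII ω t G =>
    cases E' with
    | zero => exact ((key3 hE (e ▸ res0)).2.ne rfl).elim
    | whole => exact ((key3 hE (e ▸ res1)).1.ne rfl).elim
    | typeII τ' => exact ((key3 hE (e ▸ res2 τ')).2.ne rfl).elim
    | typeIII ω' t' G' =>
      obtain ⟨κ, -, hs⟩ := h.hasShape_typeIII hE
      obtain ⟨κ', -, hs'⟩ := h.hasShape_typeIII hE'
      rw [e] at hs
      obtain ⟨rfl, -, rfl, rfl⟩ := h.shape_unique hs hs'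
      rfl
    | typeIV ω' μ' t' G' => exact (key34 hE hE' e).elim
  | typeIV ω μ t G =>
    cases E' with
    | zero => exact ((key4 hE (e ▸ res0)).2.ne rfl).elim
    | whole => exact ((key4 hE (e ▸ res1)).1.ne rfl).elim
    | typeII τ' => exact ((key4 hE (e ▸ res2 τ')).2.ne rfl).elim
    | typeIII ω' t' G' => exact (key34 hE' hE e.symm).elim
    | typeIV ω' μ' t' G' =>
      have hs := h.hasShape_typeIV hE
      rw [e] at hs
      obtain ⟨rfl, rfl, rfl, rfl⟩ := h.shape_unique hs (h.hasShape_typeIV hE')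
      rfl

lemma IsLocalData.toIdeal_surjOn (h : IsLocalData cγ φf N Sf) :
    Set.SurjOn (Entry.toIdeal γ N f g) {E | Entry.IsListed γ N f g T E} Set.univ := by
  intro I _
  obtain ⟨ω, hωN, hω⟩ := h.exists_isLeast_res I
  obtain ⟨μ, hμN, hμ⟩ := h.exists_isLeast_tor I
  obtain rfl | hω0 := Nat.eq_zero_or_pos ω
  · refine ⟨.whole, trivial, ?_⟩
    obtain ⟨y, hy⟩ := hω.1
    refine (Ideal.eq_top_of_isUnit_mem I hy ?_).symm
    convert h.isUnit_add isUnit_one 0 y using 1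
    ring
  obtain hωN | hωN := hωN.eq_or_lt
  · rw [hωN] at hω
    have hI : I = Ideal.span {cγ * φf ^ μ} := by
      obtain ⟨w, hw⟩ := h.dvd_pow
      rw [h.eq_span_pair hω hμ (y := -w) (by rw [hw]; ring_nf; exact I.zero_mem), hw]
      rw [show cγ * w + cγ * -w = 0 by ring, Ideal.span_insert, Ideal.span_singleton_zero, bot_sup_eq]
    obtain hμN | hμN := hμN.eq_or_lt
    · exact ⟨.zero, trivial, by
        rw [hI, h.c_mul_pow hμN.ge, Ideal.span_singleton_zero]; rfl⟩
    · exact ⟨.typeII μ, hμN, hI.symm⟩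
  obtain ⟨y, hy⟩ := hω.1
  -- The lift is adjusted by a multiple of `c φ ^ μ ∈ I`, so its tail can be normalized with bound
  -- `μ`.
  obtain ⟨t, G, hG, w, hw⟩ := h.exists_normalTail y μ
  have hmem : φf ^ ω + cγ * (φf ^ t * G) ∈ I := by
    convert I.sub_mem hy (I.mul_mem_right w hμ.1) using 1
    linear_combination -hw
  have hI := h.eq_span_pair hω hμ hmem
  obtain ⟨κ, -, hκ⟩ := h.exists_isLeast_tor (Ideal.span {φf ^ ω + cγ * (φf ^ t * G)})
  have hκω : κ ≤ ω := hκ.2 (h.mem_tor_of_mem_res ⟨_, Ideal.subset_span rfl⟩)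
  have hle : Ideal.span {φf ^ ω + cγ * (φf ^ t * G)} ≤ I := by
    rwa [Ideal.span_le, Set.singleton_subset_iff]
  -- The principal ideal lies in `I`, whence `μ ≤ κ`. Equality means that it already contains `c φ ^
  -- μ` and so is all of `I`.
  obtain rfl | hμκ := (hμ.2 (hle hκ.1) : μ ≤ κ).eq_or_lt
  · refine ⟨.typeIII ω t G, ⟨hω0, hωN, μ, ?_, isTail_iff.2 hG⟩, ?_⟩
    · rw [torsionExponents_eq]
      exact ⟨⟨hκω, hκ.1⟩, fun k hk => hκ.2 hk.2⟩
    · rw [toIdeal_typeIII]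
      refine le_antisymm hle ?_
      rw [hI, Ideal.span_le, Set.insert_subset_iff, Set.singleton_subset_iff]
      exact ⟨Ideal.subset_span rfl, hκ.1⟩
  · refine ⟨.typeIV ω μ t G, ⟨hωN, κ, ?_, hμκ, hκω, isTail_iff.2 hG⟩, ?_⟩
    · rwa [torsionExponents_eq]
    · rw [toIdeal_typeIV, ← hI]

lemma IsLocalData.not_isPrincipal_typeIV (h : IsLocalData cγ φf N Sf) {ω μ t : ℕ}
    {G : LocalComponent γ N f g} (hE : Entry.IsListed γ N f g T (.typeIV ω μ t G)) :
    ¬ (Entry.toIdeal γ N f g (.typeIV ω μ t G)).IsPrincipal := by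
  rintro ⟨x, hx⟩
  have hs := h.hasShape_typeIV hE
  obtain ⟨-, κ, hκ, hμκ, -⟩ := hE
  rw [torsionExponents_eq] at hκ
  rw [Ideal.submodule_span_eq] at hx
  obtain ⟨k, -, u, y, hu, rfl⟩ := h.exists_eq_unit_mul_pow x
  rw [hx] at hs
  obtain ⟨A, hA⟩ := Ideal.mem_span_singleton'.1 hs.mem
  -- A generator `u φ ^ k + c y` has `ω ≤ k`. If `A` were a non-unit, its multiple by `A` would have
  -- order above `ω` modulo `c`, yet it is `φ ^ ω` there.
  have hAu : IsUnit A := by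
    obtain hA' | ⟨z1, z2, rfl⟩ := h.isUnit_or A
    · exact hA'
    exfalso
    have hk : ω ≤ k := by
      obtain ⟨v, hv⟩ := hu.exists_left_inv
      exact hs.res.2 ⟨v * y, Ideal.mem_span_singleton'.2
        ⟨v, by linear_combination cls γ N f g f ^ k * hv⟩⟩
    have := h.le_of_eq_add (j := ω + 1) (k := ω) hs.lt isUnit_one
      (y := z1 * u * φf ^ (k - ω))
      (z := z2 * (u * φf ^ k + cγ * y) + φf * z1 * y - φf ^ t * G) (by
        have : φf ^ k = φf ^ ω * φf ^ (k - ω) := by rw [← pow_add, Nat.add_sub_of_le hk]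
        rw [pow_succ]
        linear_combination -hA + φf * z1 * u * this)
    omega
  -- Thus `I` is generated by the lift alone, and its torsion exponent would be both `μ` and `κ`.
  have : Ideal.span {u * φf ^ k + cγ * y} = Ideal.span {φf ^ ω + cγ * (φf ^ t * G)} := by
    rw [← hA, Ideal.span_singleton_mul_left_unit hAu]
  rw [this] at hs
  exact hμκ.ne (hs.tor.unique hκ)

end

end ChainCode

/-! ### Constacyclic codes and the Chinese remainder theorem. -/

namespace ChainCode

lemma wordPoly_coeff {R : Type*} [CommRing R] {L : ℕ} (d : Fin L → R) (k : ℕ) :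
    (wordPoly d).coeff k = if h : k < L then d ⟨k, h⟩ else 0 := by
  rw [wordPoly, finsetSum_coeff]
  simp only [coeff_C_mul_X_pow]
  split_ifs with h
  · rw [Finset.sum_eq_single ⟨k, h⟩]
    · simp
    · intro i _ hi
      rw [if_neg]; rintro rfl; exact hi rfl
    · simp
  · refine Finset.sum_eq_zero fun i _ => ?_
    rw [if_neg]; have := i.isLt; omega

lemma wordPoly_injective {R : Type*} [CommRing R] {L : ℕ} :
    Function.Injective (wordPoly : (Fin L → R) → R[X]) := by
  intro d e h
  ext i
  have := congrArg (fun P => P.coeff i) h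
  simpa [wordPoly_coeff] using this

lemma wordPoly_add {R : Type*} [CommRing R] {L : ℕ} (d e : Fin L → R) :
    wordPoly (d + e) = wordPoly d + wordPoly e := by
  simp [wordPoly, add_mul, Finset.sum_add_distrib]

lemma wordPoly_smul {R : Type*} [CommRing R] {L : ℕ} (x : R) (d : Fin L → R) :
    wordPoly (x • d) = C x * wordPoly d := by
  simp [wordPoly, Finset.mul_sum, mul_assoc]

/-- The shift is multiplication by `X` modulo `X ^ L - a`; the last letter is the overflowing
coefficient. -/
lemma wordPoly_constaShift {R : Type*} [CommRing R] {L : ℕ} (hL : 0 < L) (a : R) (d : Fin L → R) :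
    wordPoly (constaShift a d) =
      X * wordPoly d - C (d ⟨L - 1, by omega⟩) * (X ^ L - C a) := by
  ext k
  rw [coeff_sub, coeff_C_mul, coeff_sub, coeff_X_pow, coeff_C]
  cases k with
  | zero =>
    rw [wordPoly_coeff, dif_pos hL, mul_coeff_zero, coeff_X_zero, if_neg hL.ne]
    simp [constaShift, mul_comm]
  | succ k =>
    rw [coeff_X_mul, wordPoly_coeff, wordPoly_coeff]
    by_cases h1 : k + 1 < L
    · rw [dif_pos h1, dif_pos (by omega), if_neg h1.ne]
      simp [constaShift]
    · by_cases h2 : k + 1 = L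
      · subst h2
        simp
      · rw [dif_neg h1, dif_neg (by omega), if_neg h2]
        simp

lemma exists_wordPoly_eq {R : Type*} [CommRing R] [Nontrivial R] {L : ℕ} (hL : 0 < L) (a : R)
    (P : R[X]) : ∃ d : Fin L → R, wordPoly d = P %ₘ (X ^ L - C a) := by
  have hm : (X ^ L - C a).Monic := monic_X_pow_sub_C a hL.ne'
  refine ⟨fun i => (P %ₘ (X ^ L - C a)).coeff i, ?_⟩
  ext k
  rw [wordPoly_coeff]
  split_ifs with h
  · rfl
  · refine (coeff_eq_zero_of_degree_lt ?_).symm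
    refine (degree_modByMonic_lt P hm).trans_le ?_
    rw [degree_X_pow_sub_C hL]
    exact_mod_cast not_lt.1 h

/-- Iterated shifts give monomials and linearity gives all `Q`: a constacyclic code is an ideal
modulo `X ^ L - a`. -/
lemma X_pow_mul_wordPoly_mem {R : Type*} [CommRing R] [Nontrivial R] {L : ℕ} (hL : 0 < L) {a : R}
    {D : Submodule R (Fin L → R)} (hD : IsConstacyclic a D) {d : Fin L → R} (hd : d ∈ D) (Q : R[X]) :
    ∃ e ∈ D, X ^ L - C a ∣ Q * wordPoly d - wordPoly e := by
  induction Q using Polynomial.induction_on' with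
  | add P Q hP hQ =>
    obtain ⟨e, he, h1⟩ := hP
    obtain ⟨e', he', h2⟩ := hQ
    refine ⟨e + e', D.add_mem he he', ?_⟩
    rw [wordPoly_add]
    convert dvd_add h1 h2 using 1
    ring
  | monomial k r =>
    rw [← C_mul_X_pow_eq_monomial]
    induction k with
    | zero => exact ⟨r • d, D.smul_mem r hd, by rw [wordPoly_smul]; simp⟩
    | succ k ih =>
      obtain ⟨e, he, w, hw⟩ := ih
      refine ⟨_, hD e he, X * w + C (e ⟨L - 1, by omega⟩), ?_⟩
      rw [wordPoly_constaShift hL, pow_succ]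
      linear_combination X * hw

section

variable {R : Type*} [CommRing R] {γ : R} {N L : ℕ} {r : ℕ} {f g : Fin r → R[X]} {α : R}

lemma isConstacyclic_directSumCode (hL : 0 < L)
    (hprod : ∏ j, (f j ^ N + C γ * g j) = X ^ L - C α)
    (I : ∀ j, Ideal (LocalComponent γ N (f j) (g j))) :
    IsConstacyclic α (directSumCode γ N L f g I) := by
  intro d hd j
  have h0 : cls γ N (f j) (g j) (X ^ L - C α) = 0 := by
    rw [Ideal.Quotient.eq_zero_iff_mem, Ideal.mem_span_singleton, ← hprod]
    exact Finset.dvd_prod_of_mem _ (Finset.mem_univ j)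
  rw [wordPoly_constaShift hL, map_sub, map_mul, map_mul _ (C _), h0, mul_zero, sub_zero]
  exact (I j).mul_mem_left _ (hd j)

lemma exists_idempotent {A ι : Type*} [CommRing A] [Fintype ι] [DecidableEq ι] {h : ι → A}
    (hcop : Pairwise fun i j => IsCoprime (h i) (h j)) (j : ι) :
    ∃ e, h j ∣ e - 1 ∧ ∀ i ≠ j, h i ∣ e := by
  have : IsCoprime (h j) (∏ i ∈ Finset.univ.erase j, h i) :=
    IsCoprime.prod_right fun i hi => hcop (Finset.ne_of_mem_erase hi).symm
  obtain ⟨u, v, huv⟩ := this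
  refine ⟨v * ∏ i ∈ Finset.univ.erase j, h i, ⟨-u, by linear_combination huv⟩, fun i hi => ?_⟩
  exact (Finset.dvd_prod_of_mem _ (Finset.mem_erase.2 ⟨hi, Finset.mem_univ i⟩)).mul_left v

lemma cls_eq_iff {f g P Q : R[X]} : cls γ N f g P = cls γ N f g Q ↔ f ^ N + C γ * g ∣ P - Q := by
  rw [Ideal.Quotient.eq, Ideal.mem_span_singleton]

/-- Multiplying by the `j`-th idempotent places an element of `I j` in a word whose other classes
vanish. That word lies in both codes, so the element lies in `J j`. -/
lemma directSumCode_injective [Nontrivial R] (hL : 0 < L)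
    (hprod : ∏ j, (f j ^ N + C γ * g j) = X ^ L - C α)
    (hcop : Pairwise fun i j => IsCoprime (f i ^ N + C γ * g i) (f j ^ N + C γ * g j)) :
    Function.Injective (directSumCode γ N L f g) := by
  have key : ∀ I J, directSumCode γ N L f g I = directSumCode γ N L f g J → ∀ j, I j ≤ J j := by
    intro I J e j x hx
    obtain ⟨P, rfl⟩ := Ideal.Quotient.mk_surjective x
    obtain ⟨q, hq, hq'⟩ := exists_idempotent hcop j
    obtain ⟨d, hd⟩ := exists_wordPoly_eq hL α (q * P)
    have hcls : ∀ i, cls γ N (f i) (g i) (wordPoly d) = cls γ N (f i) (g i) (q * P) := by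
      intro i
      rw [cls_eq_iff, hd, modByMonic_eq_sub_mul_div, sub_sub_cancel_left, dvd_neg]
      refine Dvd.dvd.mul_right ?_ _
      rw [← hprod]
      exact Finset.dvd_prod_of_mem _ (Finset.mem_univ i)
    have hj : cls γ N (f j) (g j) (q * P) = cls γ N (f j) (g j) P := by
      rw [cls_eq_iff, show q * P - P = (q - 1) * P by ring]
      exact hq.mul_right P
    have hdI : d ∈ directSumCode γ N L f g I := by
      intro i
      rw [hcls]
      by_cases hi : i = j
      · subst hi; rw [hj]; exact hx
      · have : cls γ N (f i) (g i) (q * P) = 0 := by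
          rw [← map_zero (cls γ N (f i) (g i)), cls_eq_iff, sub_zero]
          exact (hq' i hi).mul_right P
        rw [this]; exact (I i).zero_mem
    rw [e] at hdI
    have := hdI j
    rwa [hcls, hj] at this
  intro I J e
  funext j
  exact le_antisymm (key I J e j) (key J I e.symm j)

/-- Take for `I j` the image of `D` in the `j`-th component. A word whose classes all come from
words `w j ∈ D` is recovered by gluing these with the idempotents, which stays inside `D`. -/
lemma exists_directSumCode_eq [Nontrivial R] (hL : 0 < L)
    (hprod : ∏ j, (f j ^ N + C γ * g j) = X ^ L - C α)
    (hcop : Pairwise fun i j => IsCoprime (f i ^ N + C γ * g i) (f j ^ N + C γ * g j))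
    {D : Submodule R (Fin L → R)} (hD : IsConstacyclic α D) :
    ∃ I, directSumCode γ N L f g I = D := by
  have hM : ∀ j, f j ^ N + C γ * g j ∣ X ^ L - C α := fun j => by
    rw [← hprod]; exact Finset.dvd_prod_of_mem _ (Finset.mem_univ j)
  refine ⟨fun j =>
    { carrier := {x | ∃ d ∈ D, cls γ N (f j) (g j) (wordPoly d) = x}
      add_mem' := ?_
      zero_mem' := ⟨0, D.zero_mem, by simp [wordPoly]⟩
      smul_mem' := ?_ }, ?_⟩
  · rintro _ _ ⟨d, hd, rfl⟩ ⟨e, he, rfl⟩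
    exact ⟨d + e, D.add_mem hd he, by rw [wordPoly_add, map_add]⟩
  · rintro x _ ⟨d, hd, rfl⟩
    obtain ⟨Q, rfl⟩ := Ideal.Quotient.mk_surjective x
    obtain ⟨e, he, h⟩ := X_pow_mul_wordPoly_mem hL hD hd Q
    refine ⟨e, he, ?_⟩
    rw [smul_eq_mul, ← map_mul, eq_comm, cls_eq_iff]
    exact (hM j).trans h
  · ext d
    refine ⟨fun hd => ?_, fun hd j => ⟨d, hd, rfl⟩⟩
    choose w hw hwd using hd
    choose q hq hq' using exists_idempotent hcop
    choose e he hed using fun j => X_pow_mul_wordPoly_mem hL hD (hw j) (q j)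
    have hdvd : ∀ i, f i ^ N + C γ * g i ∣ wordPoly d - ∑ j, wordPoly (e j) := by
      intro i
      rw [← cls_eq_iff, map_sum, Finset.sum_eq_single i]
      · rw [← hwd i, cls_eq_iff]
        have h1 := (hM i).trans (hed i)
        have h2 := (hq i).mul_right (wordPoly (w i))
        convert dvd_sub h1 h2 using 1
        ring
      · intro j _ hj
        rw [← map_zero (cls γ N (f i) (g i)), cls_eq_iff, sub_zero]
        have h1 := (hM i).trans (hed j)
        have h2 := (hq' j i hj.symm).mul_right (wordPoly (w j))
        convert dvd_sub h2 h1 using 1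
        ring
      · simp
    have hsum : ∑ j, wordPoly (e j) = wordPoly (∑ j, e j) := by
      have : ∀ s : Finset (Fin r), ∑ j ∈ s, wordPoly (e j) = wordPoly (∑ j ∈ s, e j) := by
        intro s
        induction s using Finset.induction_on with
        | empty => simp [wordPoly]
        | insert a s ha ih => rw [Finset.sum_insert ha, Finset.sum_insert ha, wordPoly_add, ih]
      exact this _
    have hall := Fintype.prod_dvd_of_coprime hcop hdvd
    rw [hprod, hsum] at hall
    have hdeg : ∀ d : Fin L → R, (wordPoly d).degree < L := by
      intro d
      rw [degree_lt_iff_coeff_zero]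
      intro k hk
      rw [wordPoly_coeff, dif_neg (by omega)]
    have hm : (X ^ L - C α).Monic := monic_X_pow_sub_C α hL.ne'
    -- Both word polynomials have degree below `L`, so congruence modulo the monic `X ^ L - α` is
    -- equality.
    have h0 : wordPoly d - wordPoly (∑ j, e j) = 0 := by
      by_contra hne
      refine hm.not_dvd_of_degree_lt hne ?_ hall
      rw [degree_X_pow_sub_C hL]
      exact (degree_sub_le _ _).trans_lt (max_lt (hdeg _) (hdeg _))
    rw [wordPoly_injective (sub_eq_zero.1 h0)]
    exact D.sum_mem fun j _ => he j

end

end ChainCode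

/-! ### Lifting factorizations, Teichmüller representatives, and existence. -/

namespace ChainCode

/-- Over a field, a separable monic polynomial is a product of pairwise coprime monic irreducible
ones. -/
lemma exists_prod_irreducible {F : Type*} [Field F] {P : F[X]} (hP : P.Monic) (hs : P.Separable) :
    ∃ (r : ℕ) (q : Fin r → F[X]), (∀ j, (q j).Monic) ∧ (∀ j, Irreducible (q j)) ∧
      (Pairwise fun i j => IsCoprime (q i) (q j)) ∧ ∏ j, q j = P := by
  classical
  have hnd := (UniqueFactorizationMonoid.squarefree_iff_nodup_normalizedFactors hP.ne_zero).1
    hs.squarefree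
  set s := (UniqueFactorizationMonoid.normalizedFactors P).toFinset with hsdef
  have hirr : ∀ x ∈ s, Irreducible x := fun x hx =>
    UniqueFactorizationMonoid.irreducible_of_normalized_factor x (Multiset.mem_toFinset.1 hx)
  have hmon : ∀ x ∈ s, x.Monic := fun x hx => by
    rw [← UniqueFactorizationMonoid.normalize_normalized_factor x (Multiset.mem_toFinset.1 hx)]
    exact monic_normalize (hirr x hx).ne_zero
  refine ⟨s.card, fun j => s.equivFin.symm j, fun j => hmon _ (Subtype.coe_prop _),
    fun j => hirr _ (Subtype.coe_prop _), ?_, ?_⟩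
  · intro i j hij
    have hi := Subtype.coe_prop (s.equivFin.symm i)
    have hj := Subtype.coe_prop (s.equivFin.symm j)
    refine (hirr _ hi).coprime_iff_not_dvd.2 fun hd => hij ?_
    have := eq_of_monic_of_associated (hmon _ hi) (hmon _ hj)
      (((hirr _ hi).dvd_irreducible_iff_associated (hirr _ hj)).1 hd)
    exact s.equivFin.symm.injective (Subtype.ext this)
  · rw [Equiv.prod_comp s.equivFin.symm (fun x : s => (x : F[X])), Finset.prod_coe_sort s (fun x => x)]
    have := leadingCoeff_mul_prod_normalizedFactors P
    rw [hP.leadingCoeff, C_1, one_mul] at this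
    conv_rhs => rw [← this]
    rw [hsdef, Finset.prod, Multiset.toFinset_val, hnd.dedup, Multiset.map_id']

namespace IsReduction

variable {R F : Type*} [CommRing R] [Field F] {γ : R} {π : R →+* F}

/-- A lifted Bézout relation has value `1 + γ z`, whose inverse is `1 - γ z` because `γ ^ 2 = 0`. -/
lemma isCoprime_of_map (h : IsReduction γ π) {a b : R[X]}
    (hab : IsCoprime (a.map π) (b.map π)) : IsCoprime a b := by
  obtain ⟨A, B, e⟩ := hab
  obtain ⟨A, rfl⟩ := h.exists_poly_map_eq A
  obtain ⟨B, rfl⟩ := h.exists_poly_map_eq B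
  rw [← Polynomial.map_mul, ← Polynomial.map_mul, ← Polynomial.map_add,
    ← Polynomial.map_one π, h.poly_map_eq_iff] at e
  obtain ⟨z, hz⟩ := e
  exact ⟨(1 - C γ * z) * A, (1 - C γ * z) * B, by
    linear_combination (1 - C γ * z) * hz - z ^ 2 * h.C_mul_C⟩

lemma map_C_mul (h : IsReduction γ π) (P : R[X]) : (C γ * P).map π = 0 :=
  (h.poly_map_eq_zero_iff _).2 (dvd_mul_right _ _)

/-- A factorization modulo `γ` into pairwise coprime factors lifts. -/
lemma exists_prod_eq (h : IsReduction γ π) {ι : Type*} (a : ι → R[X])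
    (hcop : Pairwise fun i j => IsCoprime (a i) (a j)) {s : Finset ι} (hs : s.Nonempty) (P : R[X])
    (hP : (∏ j ∈ s, a j).map π = P.map π) : ∃ w : ι → R[X], ∏ j ∈ s, (a j + C γ * w j) = P := by
  classical
  induction hs using Finset.Nonempty.cons_induction generalizing P with
  | singleton i =>
    obtain ⟨z, hz⟩ := (h.poly_map_eq_iff _ _).1 hP.symm
    exact ⟨fun _ => z, by rw [Finset.prod_singleton, hz, Finset.prod_singleton]⟩
  | cons i s hi hs ih =>
    obtain ⟨z, hz⟩ := (h.poly_map_eq_iff _ _).1 hP.symm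
    obtain ⟨u, v, huv⟩ : IsCoprime (a i) (∏ j ∈ s, a j) :=
      IsCoprime.prod_right fun j hj => hcop (by rintro rfl; exact hi hj)
    -- With `1 = u a + v b`, where `a = a i` and `b` is the product of the rest, the error `γ z` is
    -- absorbed: `a b + γ z = (a + γ v z) (b + γ u z)`.
    obtain ⟨w, hw⟩ := ih (∏ j ∈ s, a j + C γ * (u * z)) (by
      rw [Polynomial.map_add, h.map_C_mul, add_zero])
    refine ⟨Function.update w i (v * z), ?_⟩
    rw [Finset.prod_cons, Function.update_self]
    have : ∏ j ∈ s, (a j + C γ * Function.update w i (v * z) j) = ∏ j ∈ s, (a j + C γ * w j) :=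
      Finset.prod_congr rfl fun j hj => by
        rw [Function.update_of_ne (by rintro rfl; exact hi hj)]
    rw [this, hw, hz, Finset.prod_cons]
    linear_combination C γ * z * huv + u * v * z ^ 2 * h.C_mul_C

/-- A factorization of a monic polynomial modulo `γ` into pairwise coprime monic factors lifts to
one with monic factors. -/
lemma exists_monic_prod_eq (h : IsReduction γ π) {r : ℕ} [Nonempty (Fin r)] (q : Fin r → F[X])
    (hmon : ∀ j, (q j).Monic) (hcop : Pairwise fun i j => IsCoprime (q i) (q j)) {P : R[X]}
    (hPm : P.Monic) (hP : ∏ j, q j = P.map π) :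
    ∃ f : Fin r → R[X], (∀ j, (f j).Monic) ∧ (∀ j, (f j).map π = q j) ∧ ∏ j, f j = P := by
  have hnt : Nontrivial R := π.domain_nontrivial
  choose a haq _ ham using fun j => lifts_and_degree_eq_and_monic (f := π) (p := q j)
    ((mem_lifts _).2 (h.exists_poly_map_eq _)) (hmon j)
  obtain ⟨w, hw⟩ := h.exists_prod_eq a
    (fun i j hij => h.isCoprime_of_map (by rw [haq, haq]; exact hcop hij))
    Finset.univ_nonempty P (by rw [Polynomial.map_prod, ← hP]; simp only [haq])
  -- Reducing the correction modulo `a j` keeps its degree below that of `a j`, so the corrected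
  -- factor stays monic.
  have hfm : ∀ j, (a j + C γ * (w j %ₘ a j)).Monic := fun j => by
    refine (ham j).add_of_left (lt_of_le_of_lt ?_ (degree_modByMonic_lt (w j) (ham j)))
    rw [← smul_eq_C_mul]
    exact degree_smul_le _ _
  have hfq : ∀ j, (a j + C γ * (w j %ₘ a j)).map π = q j := fun j => by
    rw [Polynomial.map_add, h.map_C_mul, add_zero, haq]
  refine ⟨fun j => a j + C γ * (w j %ₘ a j), hfm, hfq, ?_⟩
  have hM := monic_prod_of_monic Finset.univ _ fun j _ => hfm j
  refine (eq_of_monic_of_dvd_of_natDegree_le hM hPm ?_ ?_).symm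
  -- Each `a + γ w` is `(a + γ (w mod a)) (1 + γ (w div a))`, so the monic product divides `P`; the
  -- degrees agree modulo `γ`.
  · refine ⟨∏ j, (1 + C γ * (w j /ₘ a j)), ?_⟩
    rw [← hw, ← Finset.prod_mul_distrib]
    refine Finset.prod_congr rfl fun j _ => ?_
    have e := modByMonic_add_div (w j) (a j)
    linear_combination -C γ * e - (w j %ₘ a j) * (w j /ₘ a j) * h.C_mul_C
  · rw [← hPm.natDegree_map π, ← hM.natDegree_map π, Polynomial.map_prod]
    simp only [hfq]
    rw [hP]

end IsReduction

/-- In a chain ring with maximal ideal `⟨γ⟩` and `γ ^ 2 = 0 ≠ γ`, the annihilator of `γ`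
is `⟨γ⟩`. -/
lemma IsChainRing.mul_eq_zero_iff {R : Type*} [CommRing R] (hchain : IsChainRing R) {γ : R}
    (hmax : (Ideal.span {γ}).IsMaximal) (hnil : nilpotencyClass γ = 2) (x : R) :
    γ * x = 0 ↔ γ ∣ x := by
  obtain ⟨h2, h1⟩ := nilpotencyClass_eq_succ_iff.1 hnil
  rw [pow_one] at h1
  constructor
  · intro h
    rw [← Ideal.mem_span_singleton]
    obtain hle | hle := hchain (Ideal.span {x}) (Ideal.span {γ})
    · exact hle (Ideal.mem_span_singleton_self x)
    · by_contra hx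
      -- By maximality `⟨x⟩` is everything, and then `γ x = 0` contradicts `γ ≠ 0`, or it is `⟨γ⟩`.
      obtain htop | heq := (Ideal.isMaximal_def.1 hmax).le_iff.1 hle
      · rw [Ideal.span_singleton_eq_top] at htop
        exact h1 ((htop.mul_left_eq_zero).1 h)
      · exact hx (heq ▸ Ideal.mem_span_singleton_self x)
  · rintro ⟨y, rfl⟩
    rw [← mul_assoc, ← sq, h2, zero_mul]

section Teichmuller

variable {R F : Type*} [CommRing R] [Field F] {γ : R} {π : R →+* F}

lemma IsReduction.one_add_pow (h : IsReduction γ π) (z : R) (k : ℕ) :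
    (1 + γ * z) ^ k = 1 + k * (γ * z) := by
  induction k with
  | zero => simp
  | succ k ih =>
    rw [pow_succ, ih]
    push_cast
    linear_combination k * z ^ 2 * h.mul_self

/-- Reduction preserves the order of `ζ`: if `ζ ^ k = 1 + γ z`, then `ζ ^ (k p) = 1 + p γ z = 1`
since `γ ∣ p`, and `p` is prime to `p ^ m - 1`. -/
lemma IsReduction.dvd_of_map_pow_eq_one (h : IsReduction γ π) {p m : ℕ} (hp : p.Prime) (hm : m ≠ 0)
    (hpF : (p : F) = 0) {ζ : R} (hζ : orderOf ζ = p ^ m - 1) {k : ℕ} (hk : π ζ ^ k = 1) :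
    p ^ m - 1 ∣ k := by
  have h1 : π (ζ ^ k - 1) = 0 := by rw [map_sub, map_pow, hk, map_one, sub_self]
  obtain ⟨z, hz⟩ := (h.map_eq_zero_iff _).1 h1
  obtain ⟨y, hy⟩ := (h.map_eq_zero_iff (p : R)).1 (by rw [map_natCast, hpF])
  have h2 : ζ ^ (k * p) = 1 := by
    rw [pow_mul, show ζ ^ k = 1 + γ * z by linear_combination hz, h.one_add_pow, hy]
    linear_combination y * z * h.mul_self
  have h3 := hζ ▸ orderOf_dvd_of_pow_eq_one h2
  refine Nat.Coprime.dvd_of_dvd_mul_right ?_ h3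
  have h4 : (p ^ m - 1).Coprime (p ^ m) := by
    have : 0 < p ^ m := pow_pos hp.pos m
    rw [Nat.coprime_self_sub_left this]
    exact Nat.coprime_one_left _
  exact (Nat.coprime_pow_right_iff (Nat.pos_of_ne_zero hm) _ _).1 h4

/-- The residue of `ζ` is a primitive root of order `|F| - 1`, so its powers run once through the
nonzero elements of `F`. -/
lemma IsReduction.bijOn_teichmullerSet (h : IsReduction γ π) [Finite F] {p m : ℕ} (hp : p.Prime)
    (hm : m ≠ 0) (hpF : (p : F) = 0) (hcard : Nat.card F = p ^ m) {ζ : R}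
    (hζ : orderOf ζ = p ^ m - 1) : Set.BijOn π (teichmullerSet ζ (p ^ m)) Set.univ := by
  have hq : 1 < p ^ m := Nat.one_lt_pow hm hp.one_lt
  have hζ1 : ζ ^ (p ^ m - 1) = 1 := hζ ▸ pow_orderOf_eq_one ζ
  have hprim : IsPrimitiveRoot (π ζ) (p ^ m - 1) :=
    ⟨by rw [← map_pow, hζ1, map_one], fun k hk => h.dvd_of_map_pow_eq_one hp hm hpF hζ hk⟩
  have hne : NeZero (p ^ m - 1) := ⟨by omega⟩
  have hz0 : π ζ ≠ 0 := hprim.ne_zero hne.out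
  refine ⟨fun _ _ => Set.mem_univ _, ?_, ?_⟩
  · rintro _ (rfl | ⟨i, hi, rfl⟩) _ (rfl | ⟨j, hj, rfl⟩) e
    · rfl
    · rw [map_zero, map_pow] at e
      exact absurd e.symm (pow_ne_zero _ hz0)
    · rw [map_zero, map_pow] at e
      exact absurd e (pow_ne_zero _ hz0)
    · rw [map_pow, map_pow] at e
      rw [hprim.pow_inj hi hj e]
  · intro x _
    by_cases hx : x = 0
    · exact ⟨0, Or.inl rfl, by rw [map_zero, hx]⟩
    · have := Fintype.ofFinite F
      have hx1 := FiniteField.pow_card_sub_one_eq_one x hx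
      rw [← Nat.card_eq_fintype_card, hcard] at hx1
      obtain ⟨i, hi, e⟩ := hprim.eq_pow_of_pow_eq_one hx1
      exact ⟨ζ ^ i, Or.inr ⟨i, hi, rfl⟩, by rw [map_pow, e]⟩

/-- The exponent `p ^ s` is prime to the order of `ζ`, so it has an inverse `b` modulo that order.
-/
lemma exists_teichmuller_root {p m : ℕ} (hp : p.Prime) (hm : m ≠ 0) {ζ : R}
    (hζ : orderOf ζ = p ^ m - 1) (s : ℕ) {α : R} (hα : α ∈ teichmullerSet ζ (p ^ m))
    (hα0 : α ≠ 0) : ∃ α₀ ∈ teichmullerSet ζ (p ^ m), α₀ ^ p ^ s = α := by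
  have hq : 1 < p ^ m := Nat.one_lt_pow hm hp.one_lt
  obtain rfl | ⟨i, -, rfl⟩ := hα
  · exact absurd rfl hα0
  have hco : (p ^ s).Coprime (orderOf ζ) := by
    rw [hζ]
    refine Nat.Coprime.pow_left _ ?_
    have h4 : (p ^ m).Coprime (p ^ m - 1) := by
      rw [Nat.coprime_self_sub_right hq.le]
      exact Nat.coprime_one_right _
    exact (Nat.coprime_pow_left_iff (Nat.pos_of_ne_zero hm) _ _).1 h4
  obtain ⟨b, hb⟩ := exists_pow_eq_self_of_coprime hco
  refine ⟨ζ ^ (b * i), Or.inr ⟨b * i % (p ^ m - 1), Nat.mod_lt _ (by omega), ?_⟩, ?_⟩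
  · rw [← hζ, pow_mod_orderOf]
  · rw [← pow_mul, show b * i * p ^ s = p ^ s * b * i by ring, pow_mul, pow_mul, hb]

end Teichmuller

lemma IsReduction.exists_isFactorization {R F : Type*} [CommRing R] [Field F] {γ : R} {π : R →+* F}
    (h : IsReduction γ π) (hirr : ∀ f, Irreducible (f.map π) → IsBasicIrreducible γ f) {p : ℕ}
    (hp : p.Prime) (hpF : (p : F) = 0) {n s : ℕ} (hn : 0 < n) (hnp : n.Coprime p) {T : Set R}
    {α α₀ : R} (hα₀ : α₀ ∈ T) (hpow : α₀ ^ p ^ s = α) (hu : π α₀ ≠ 0) :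
    ∃ (r : ℕ) (f g : Fin r → R[X]), IsFactorization γ T α n p s α₀ f g := by
  have hfact : Fact p.Prime := ⟨hp⟩
  have hchar : CharP F p := (CharP.charP_iff_prime_eq_zero hp).2 hpF
  have hn0 : (n : F) ≠ 0 := fun h0 => by
    have h1 := (CharP.cast_eq_zero_iff F p n).1 h0
    have h2 : p ∣ 1 := hnp ▸ Nat.dvd_gcd h1 dvd_rfl
    exact hp.one_lt.ne' (Nat.dvd_one.1 h2)
  obtain ⟨r, q, hqm, hqi, hqc, hq⟩ := exists_prod_irreducible (monic_X_pow_sub_C (π α₀) hn.ne')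
    (separable_X_pow_sub_C (π α₀) hn0 hu)
  -- Lifting puts the correction into some factor, so the product must not be empty; `0 < n` ensures
  -- this.
  have hr : Nonempty (Fin r) := by
    by_contra hr
    rw [not_nonempty_iff] at hr
    rw [Finset.univ_eq_empty, Finset.prod_empty] at hq
    have := congrArg natDegree hq
    rw [natDegree_one, natDegree_X_pow_sub_C] at this
    omega
  obtain ⟨f, hfm, hfq, hf⟩ := h.exists_monic_prod_eq q hqm hqc (monic_X_pow_sub_C α₀ hn.ne')
    (by rw [hq]; simp)
  have hfc : Pairwise fun i j => IsCoprime (f i) (f j) := fun i j hij =>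
    h.isCoprime_of_map (by rw [hfq, hfq]; exact hqc hij)
  -- By Frobenius, `X ^ (n * p ^ s) - α` is `(X ^ n - α₀) ^ p ^ s` modulo `γ`, so the coprime powers
  -- `f j ^ p ^ s` can be lifted.
  obtain ⟨g, hg⟩ := h.exists_prod_eq (fun j => f j ^ p ^ s) (fun i j hij => (hfc hij).pow)
    Finset.univ_nonempty (X ^ (n * p ^ s) - C α) (by
      rw [Finset.prod_pow, hf, ← hpow]
      simp only [Polynomial.map_pow, Polynomial.map_sub, map_X, map_C, map_pow]
      rw [sub_pow_char_pow, pow_mul])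
  exact ⟨r, f, g, hα₀, hpow, hfm, fun j => hirr _ (by rw [hfq]; exact hqi j), hfc, hf, hg⟩

end ChainCode

/-! ### Assembly of the classification. -/

/-- The classification, stated for a reduction map onto any field in place of `R ⧸ ⟨γ⟩`. -/
lemma ChainCode.IsReduction.classification {R F : Type*} [CommRing R] [Field F] [Finite F] {γ : R}
    {π : R →+* F} (hR : ChainCode.IsReduction γ π)
    (hirr : ∀ f, ChainCode.IsBasicIrreducible γ f ↔ Irreducible (f.map π))
    {p m : ℕ} (hp : p.Prime) (hcard : Nat.card F = p ^ m) {ζ : R} (hζ : orderOf ζ = p ^ m - 1)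
    {n s : ℕ} (hn : 0 < n) (hnp : n.Coprime p)
    {α : R} (hα : α ∈ ChainCode.teichmullerSet ζ (p ^ m)) (hα0 : α ≠ 0) :
    (∃ (α₀ : R) (r : ℕ) (f g : Fin r → R[X]),
      ChainCode.IsFactorization γ (ChainCode.teichmullerSet ζ (p ^ m)) α n p s α₀ f g) ∧
    ∀ (α₀ : R) (r : ℕ) (f g : Fin r → R[X]),
      ChainCode.IsFactorization γ (ChainCode.teichmullerSet ζ (p ^ m)) α n p s α₀ f g →
      (∀ j, Set.BijOn
        (ChainCode.Entry.toIdeal γ (p ^ s) (f j) (g j))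
        {E | ChainCode.Entry.IsListed γ (p ^ s) (f j) (g j)
          (ChainCode.teichmullerSet ζ (p ^ m)) E}
        Set.univ) ∧
      (∀ j ω μ t G,
        ChainCode.Entry.IsListed γ (p ^ s) (f j) (g j)
          (ChainCode.teichmullerSet ζ (p ^ m)) (.typeIV ω μ t G) →
        ¬ (ChainCode.Entry.toIdeal γ (p ^ s) (f j) (g j) (.typeIV ω μ t G)).IsPrincipal) ∧
      Set.BijOn
        (fun E : ∀ j, ChainCode.Entry (ChainCode.LocalComponent γ (p ^ s) (f j) (g j)) =>
          ChainCode.directSumCode γ (p ^ s) (n * p ^ s) f g fun j =>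
            ChainCode.Entry.toIdeal γ (p ^ s) (f j) (g j) (E j))
        {E | ∀ j, ChainCode.Entry.IsListed γ (p ^ s) (f j) (g j)
          (ChainCode.teichmullerSet ζ (p ^ m)) (E j)}
        {D : Submodule R (Fin (n * p ^ s) → R) | ChainCode.IsConstacyclic α D} := by
  have hm : m ≠ 0 := by
    rintro rfl
    have := Finite.one_lt_card (α := F)
    rw [hcard, pow_zero] at this
    exact this.false
  have hpF : (p : F) = 0 := by
    have := Fintype.ofFinite (F)
    have h0 := Nat.cast_card_eq_zero (F)
    rw [← Nat.card_eq_fintype_card, hcard, Nat.cast_pow] at h0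
    exact eq_zero_of_pow_eq_zero h0
  have hT := hR.bijOn_teichmullerSet hp hm hpF hcard hζ
  have hT0 : (0 : R) ∈ ChainCode.teichmullerSet ζ (p ^ m) := Or.inl rfl
  have hN : 0 < p ^ s := pow_pos hp.pos s
  refine ⟨?_, ?_⟩
  · obtain ⟨α₀, hα₀, hpow⟩ := ChainCode.exists_teichmuller_root hp hm hζ s hα hα0
    have hu : π α₀ ≠ 0 := fun h0 => by
      -- Zero is the only Teichmüller element with residue zero. A nonzero residue is what makes `X
      -- ^ n - α₀` separable modulo `γ`.
      have : α₀ = 0 := hT.injOn hα₀ hT0 (by rw [h0, map_zero])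
      rw [this, zero_pow hN.ne'] at hpow
      exact hα0 hpow.symm
    obtain ⟨r, f, g, h⟩ := hR.exists_isFactorization (fun f => (hirr f).2) hp hpF hn hnp hα₀ hpow hu
    exact ⟨α₀, r, f, g, h⟩
  · intro α₀ r f g h
    have hloc := fun j => hR.isLocalData (g := g j) hN (h.monic j) ((hirr _).1 (h.basicIrreducible j)) hT0 hT
    have hnt : Nontrivial R := π.domain_nontrivial
    have hL : 0 < n * p ^ s := Nat.mul_pos hn hN
    have hcop : Pairwise fun i j =>
        IsCoprime (f i ^ p ^ s + C γ * g i) (f j ^ p ^ s + C γ * g j) := fun i j hij => by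
      refine hR.isCoprime_of_map ?_
      have hij' : IsCoprime ((f i).map π) ((f j).map π) :=
        (h.coprime hij).map (Polynomial.mapRingHom π)
      rw [Polynomial.map_add, Polynomial.map_add, hR.map_C_mul, hR.map_C_mul, add_zero, add_zero,
        Polynomial.map_pow, Polynomial.map_pow]
      exact hij'.pow
    refine ⟨fun j => ⟨fun _ _ => Set.mem_univ _, (hloc j).toIdeal_injOn hN,
      (hloc j).toIdeal_surjOn⟩, fun j ω μ t G hE => (hloc j).not_isPrincipal_typeIV hE,
      fun E _ => ?_, ?_, ?_⟩
    · have hE := ChainCode.isConstacyclic_directSumCode hL h.prod_lift_eq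
        fun j => ChainCode.Entry.toIdeal γ (p ^ s) (f j) (g j) (E j)
      exact hE
    · intro E hE E' hE' e
      have e' : (fun j => ChainCode.Entry.toIdeal γ (p ^ s) (f j) (g j) (E j)) =
          fun j => ChainCode.Entry.toIdeal γ (p ^ s) (f j) (g j) (E' j) :=
        ChainCode.directSumCode_injective hL h.prod_lift_eq hcop e
      funext j
      exact (hloc j).toIdeal_injOn hN (hE j) (hE' j) (congrFun e' j)
    · intro D hD
      obtain ⟨I, rfl⟩ := ChainCode.exists_directSumCode_eq hL h.prod_lift_eq hcop hD
      choose E hE hEI using fun j => (hloc j).toIdeal_surjOn (Set.mem_univ (I j))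
      have hI : (fun j => ChainCode.Entry.toIdeal γ (p ^ s) (f j) (g j) (E j)) = I := funext hEI
      exact ⟨E, hE, by rw [← hI]⟩

theorem theorem3p2 {R : Type*} [CommRing R] [Finite R]
    (hchain : ChainCode.IsChainRing R)
    (γ : R) (hmax : (Ideal.span {γ}).IsMaximal) (hnil : nilpotencyClass γ = 2)
    (p m : ℕ) (hp : p.Prime) (hcard : Nat.card (R ⧸ Ideal.span {γ}) = p ^ m)
    (ζ : R) (hζ : orderOf ζ = p ^ m - 1)
    (n s : ℕ) (hn : 0 < n) (hs : 0 < s) (hnp : n.Coprime p)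
    (α : R) (hα : α ∈ ChainCode.teichmullerSet ζ (p ^ m)) (hα0 : α ≠ 0) :
    -- the factorizations of `X ^ n - α₀` and of `X ^ (n * p ^ s) - α` exist
    (∃ (α₀ : R) (r : ℕ) (f g : Fin r → R[X]),
      ChainCode.IsFactorization γ (ChainCode.teichmullerSet ζ (p ^ m)) α n p s α₀ f g) ∧
    -- and for any choice of them:
    ∀ (α₀ : R) (r : ℕ) (f g : Fin r → R[X]),
      ChainCode.IsFactorization γ (ChainCode.teichmullerSet ζ (p ^ m)) α n p s α₀ f g →
      -- each ideal of each component is given by exactly one entry of the list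
      (∀ j, Set.BijOn
        (ChainCode.Entry.toIdeal γ (p ^ s) (f j) (g j))
        {E | ChainCode.Entry.IsListed γ (p ^ s) (f j) (g j)
          (ChainCode.teichmullerSet ζ (p ^ m)) E}
        Set.univ) ∧
      -- the ideals of Type IV are not principal
      (∀ j ω μ t G,
        ChainCode.Entry.IsListed γ (p ^ s) (f j) (g j)
          (ChainCode.teichmullerSet ζ (p ^ m)) (.typeIV ω μ t G) →
        ¬ (ChainCode.Entry.toIdeal γ (p ^ s) (f j) (g j) (.typeIV ω μ t G)).IsPrincipal) ∧
      -- each `α`-constacyclic code is given by exactly one family of entries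
      Set.BijOn
        (fun E : ∀ j, ChainCode.Entry (ChainCode.LocalComponent γ (p ^ s) (f j) (g j)) =>
          ChainCode.directSumCode γ (p ^ s) (n * p ^ s) f g fun j =>
            ChainCode.Entry.toIdeal γ (p ^ s) (f j) (g j) (E j))
        {E | ∀ j, ChainCode.Entry.IsListed γ (p ^ s) (f j) (g j)
          (ChainCode.teichmullerSet ζ (p ^ m)) (E j)}
        {D : Submodule R (Fin (n * p ^ s) → R) | ChainCode.IsConstacyclic α D} := by
  let _ : Field (R ⧸ Ideal.span {γ}) := Ideal.Quotient.field _
  have : Finite (R ⧸ Ideal.span {γ}) :=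
    Finite.of_surjective (Ideal.Quotient.mk (Ideal.span {γ})) Ideal.Quotient.mk_surjective
  have hR : ChainCode.IsReduction γ (Ideal.Quotient.mk (Ideal.span {γ})) :=
    ⟨Ideal.Quotient.mk_surjective,
      fun x => Ideal.Quotient.eq_zero_iff_mem.trans Ideal.mem_span_singleton,
      hchain.mul_eq_zero_iff hmax hnil⟩
  exact hR.classification (fun _ => Iff.rfl) hp hcard hζ hn hnp hα hα0
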